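/- Let $X$ be a complex Banach space and let $B(X)$ be the algebra of bounded linear operators on $X$, with identity $I$. A nest on $X$ is a set $\mathcal N$ of closed subspaces of $X$ that contains $\{0\}$ and $X$, is totally ordered by inclusion, and contains the intersection and the closed linear span of the union of every family of its members; it is non-trivial if $\mathcal N\neq\{\{0\},X\}$. Put $\operatorname{Alg}\mathcal N=\{T\in B(X): TN\subseteq N\text{ for all }N\in\mathcal N\}$. Write $[a,b]=ab-ba$, and define the $(n-1)$-th commutators by $p_1(x_1)=x_1$ and $p_{n}(x_1,\dots,x_{n})=[p_{n-1}(x_1,\dots,x_{n-1}),x_{n}]$ for $n\ge 2$. For $n\ge 2$, a linear map $L:\operatorname{Alg}\mathcal N\to B(X)$ is a Lie $n$-derivation if $$L(p_n(A_1,\dots,A_n))=\sum_{k=1}^n p_n(A_1,\dots,A_{k-1},L(A_k),A_{k+1},\dots,A_n)\qquad\text{for all }A_1,\dots,A_n\in\operatorname{Alg}\mathcal N,$$ and a linear map $D:\operatorname{Alg}\mathcal N\to B(X)$ is an (associative) derivation if $D(AB)=D(A)B+A\,D(B)$ for all $A,B\in\operatorname{Alg}\mathcal N$. **Theorem.** Let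 $\mathcal N$ be a non-trivial nest on a complex Banach space $X$, let $n\ge 2$, and let $L:\operatorname{Alg}\mathcal N\to B(X)$ be a linear map. Then $L$ is a Lie $n$-derivation if and only if there exist a derivation $D:\operatorname{Alg}\mathcal N\to B(X)$ and a linear map $H:\operatorname{Alg}\mathcal N\to\mathbb C I$ with $H(p_n(A_1,\dots,A_n))=0$ for all $A_1,\dots,A_n\in\operatorname{Alg}\mathcal N$ such that $L=D+H$. Moreover, if $L$ is continuous in the operator norm, then in every such decomposition $L=D+H$ both $D$ and $H$ are continuous. -/

import Mathlib

namespace NestLie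

/-- A nest on `X`: a chain of closed subspaces containing `{0}` and `X` and closed under arbitrary
intersections and under closed linear spans of arbitrary unions. -/
structure IsNest {X : Type*} [NormedAddCommGroup X] [NormedSpace ℂ X]
    (𝒩 : Set (Submodule ℂ X)) : Prop where
  isClosed : ∀ N ∈ 𝒩, IsClosed (N : Set X)
  bot_mem : ⊥ ∈ 𝒩
  top_mem : ⊤ ∈ 𝒩
  total : ∀ N₁ ∈ 𝒩, ∀ N₂ ∈ 𝒩, N₁ ≤ N₂ ∨ N₂ ≤ N₁
  sInf_mem : ∀ S ⊆ 𝒩, sInf S ∈ 𝒩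
  closure_sSup_mem : ∀ S ⊆ 𝒩, (sSup S).topologicalClosure ∈ 𝒩

/-- `Alg 𝒩`: the algebra of the bounded operators that leave every member of `𝒩` invariant. -/
def nestAlg {X : Type*} [NormedAddCommGroup X] [NormedSpace ℂ X]
    (𝒩 : Set (Submodule ℂ X)) : Subalgebra ℂ (X →L[ℂ] X) where
  carrier := {T | ∀ N ∈ 𝒩, ∀ x ∈ N, T x ∈ N}
  mul_mem' := fun {S T} hS hT N hN x hx => hS N hN (T x) (hT N hN x hx)
  add_mem' := fun {_ _} hS hT N hN x hx => N.add_mem (hS N hN x hx) (hT N hN x hx)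
  algebraMap_mem' := fun c N _ x hx => by
    simpa [Algebra.algebraMap_eq_smul_one] using N.smul_mem c hx

/-- The `(n-1)`-th commutator `p n (x₁, …, xₙ)`: `p 1 x₁ = x₁` and
`p (n+1) (x₁, …, xₙ₊₁) = [p n (x₁, …, xₙ), xₙ₊₁]`, where `[a, b] = a * b - b * a`
(the value for `n = 0` is irrelevant). -/
def p {R : Type*} [Ring R] : (n : ℕ) → (Fin n → R) → R
  | 0, _ => 0
  | 1, x => x 0
  | n + 2, x => ⁅p (n + 1) (Fin.init x), x (Fin.last (n + 1))⁆

/-- An associative derivation from a subalgebra `𝒜` of `B` into `B`, where `B` is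
regarded as an `𝒜`-bimodule by multiplication. -/
def IsDerivation {B : Type*} [Ring B] [Algebra ℂ B] {𝒜 : Subalgebra ℂ B}
    (D : 𝒜 →ₗ[ℂ] B) : Prop :=
  ∀ x y : 𝒜, D (x * y) = D x * (y : B) + (x : B) * D y

/-- A Lie `n`-derivation from a subalgebra `𝒜` of `B` into `B`: in the `k`-th summand on the right,
the `k`-th argument `x k` of `p n` is replaced by `L (x k)`. -/
def IsLieDerivation {B : Type*} [Ring B] [Algebra ℂ B] {𝒜 : Subalgebra ℂ B}
    (n : ℕ) (L : 𝒜 →ₗ[ℂ] B) : Prop :=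
  ∀ x : Fin n → 𝒜,
    L (p n x) = ∑ k : Fin n, p n (Function.update (fun i => (x i : B)) k (L (x k)))

/-- `L = D + H` where `D` is an associative derivation and `H` is a linear map into `ℂ 1` that
vanishes on every `(n-1)`-th commutator of elements of `𝒜`. -/
structure IsStandardForm {B : Type*} [Ring B] [Algebra ℂ B] {𝒜 : Subalgebra ℂ B}
    (n : ℕ) (L D H : 𝒜 →ₗ[ℂ] B) : Prop where
  derivation : IsDerivation D
  scalar : ∀ x : 𝒜, ∃ c : ℂ, H x = c • (1 : B)
  vanish : ∀ x : Fin n → 𝒜, H (p n x) = 0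
  eq_add : L = D + H

end NestLie

/-! Write f⊗u for the operator v ↦ f v • u. A derivation obeys the Leibniz rule on iterated
commutators, and a scalar-valued map contributes nothing to that rule, which gives the easy
direction. For the converse it suffices to write `L` as a derivation plus k times the inclusion plus
a scalar-valued map (`IsDerivationModCentroid`). Then k = 0, because Leibniz would count k·p_n
exactly n times. The tool for discarding unknown terms is `ScalarOfLieScalar`: an operator whose
commutators with the algebra are scalar is itself scalar.

The nest falls into one of two cases (`dense_or_exists`), according to whether the proper members
span a dense subspace.

If they do not, some f ≠ 0 kills all proper members, so every f⊗u lies in the algebra, among them an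
idempotent Q = f⊗e. After subtracting an inner derivation, L(Q) commutes with Q, and then it is
scalar. Bracketing with Q isolates the off-diagonal blocks of X = ℂe ⊕ ker f. Comparing blocks shows
that `L` is A ↦ σA − Aσ plus a scalar, where σ is read off from L(f⊗u)
(`isDerivationModCentroid_of_map_idempotent`).

If they do, X is infinite-dimensional, and a functional normalized at 1 that kills finite-rank
operators lets `L` be shifted by scalars so that unknown scalars in finite-rank identities vanish.
On a proper member, L(f⊗x) = f⊗σx + r⊗x with a common σ. Writing [A, f⊗x] through commutators of
rank-one operators gives L(A) there (`exists_local_form`). The central and scalar parts are unique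
(`local_form_unique`), so they agree on all larger members, and density finishes.

Continuity follows from the closed graph theorem: the jump of D is scalar, and it stays scalar after
multiplication by a non-scalar element. -/

namespace NestLie

/-! ### Iterated commutators and their Leibniz expansion. -/

/-- The left-normed iterated commutator `[…[[a, b₁], b₂], …, bₘ]`. -/
def iterLie {R : Type*} [Ring R] : R → List R → R
  | a, [] => a
  | a, b :: l => iterLie ⁅a, b⁆ l

section Ring

variable {R : Type*} [Ring R]

@[simp] theorem iterLie_nil (a : R) : iterLie a [] = a := rfl

@[simp] theorem iterLie_cons (a b : R) (l : List R) :
    iterLie a (b :: l) = iterLie ⁅a, b⁆ l := rfl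

theorem iterLie_append (a : R) (l m : List R) :
    iterLie a (l ++ m) = iterLie (iterLie a l) m := by
  induction l generalizing a with
  | nil => rfl
  | cons b l ih => exact ih _

@[simp] theorem iterLie_zero (l : List R) : iterLie (0 : R) l = 0 := by
  induction l with
  | nil => rfl
  | cons b l ih => simpa [Ring.lie_def] using ih

theorem p_succ_eq_iterLie (n : ℕ) (x : Fin (n + 1) → R) :
    p (n + 1) x = iterLie (x 0) (List.ofFn (Fin.tail x)) := by
  induction n with
  | zero => simp [p]
  | succ n ih =>
    rw [p, ih, List.ofFn_succ', List.concat_eq_append, iterLie_append]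
    rfl

end Ring

section Subalgebra

variable {B : Type*} [Ring B] [Algebra ℂ B] {𝒜 : Subalgebra ℂ B}

theorem coe_lie (a b : 𝒜) : ((⁅a, b⁆ : 𝒜) : B) = ⁅(a : B), (b : B)⁆ := by
  simp [Ring.lie_def]

theorem coe_iterLie (a : 𝒜) (l : List 𝒜) :
    ((iterLie a l : 𝒜) : B) = iterLie (a : B) (l.map (↑)) := by
  induction l generalizing a with
  | nil => rfl
  | cons b l ih => simp [ih, coe_lie]

/-- The Leibniz expansion of `iterLie a l` along `L`, in which the derivative of the first entry
is `d`. -/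
def iterLieDeriv (L : 𝒜 →ₗ[ℂ] B) : 𝒜 → B → List 𝒜 → B
  | _, d, [] => d
  | a, d, b :: l => iterLieDeriv L ⁅a, b⁆ (⁅d, (b : B)⁆ + ⁅(a : B), L b⁆) l

variable (L : 𝒜 →ₗ[ℂ] B)

@[simp] theorem iterLieDeriv_nil (a : 𝒜) (d : B) : iterLieDeriv L a d [] = d := rfl

@[simp] theorem iterLieDeriv_cons (a b : 𝒜) (d : B) (l : List 𝒜) :
    iterLieDeriv L a d (b :: l) =
      iterLieDeriv L ⁅a, b⁆ (⁅d, (b : B)⁆ + ⁅(a : B), L b⁆) l := rfl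

theorem iterLieDeriv_append (a : 𝒜) (d : B) (l m : List 𝒜) :
    iterLieDeriv L a d (l ++ m) = iterLieDeriv L (iterLie a l) (iterLieDeriv L a d l) m := by
  induction l generalizing a d with
  | nil => rfl
  | cons b l ih => exact ih _ _

theorem iterLieDeriv_zero_left (d : B) (l : List 𝒜) :
    iterLieDeriv L 0 d l = iterLie d (l.map (↑)) := by
  induction l generalizing d with
  | nil => rfl
  | cons b l ih =>
    have h0 : ⁅(0 : 𝒜), b⁆ = 0 := by simp [Ring.lie_def]
    have h1 : ⁅d, (b : B)⁆ + ⁅((0 : 𝒜) : B), L b⁆ = ⁅d, (b : B)⁆ := by simp [Ring.lie_def]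
    rw [iterLieDeriv_cons, h0, h1, ih]
    rfl

theorem iterLieDeriv_add (a a' : 𝒜) (d d' : B) (l : List 𝒜) :
    iterLieDeriv L (a + a') (d + d') l = iterLieDeriv L a d l + iterLieDeriv L a' d' l := by
  induction l generalizing a a' d d' with
  | nil => rfl
  | cons b l ih =>
    rw [iterLieDeriv_cons, iterLieDeriv_cons, iterLieDeriv_cons, ← ih]
    congr 1
    · simp only [Ring.lie_def]; noncomm_ring
    · simp only [Subalgebra.coe_add, Ring.lie_def]; noncomm_ring

theorem iterLieDeriv_add_map (L' : 𝒜 →ₗ[ℂ] B) (a : 𝒜) (d d' : B) (l : List 𝒜) :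
    iterLieDeriv (L + L') a (d + d') l = iterLieDeriv L a d l + iterLieDeriv L' a d' l := by
  induction l generalizing a d d' with
  | nil => rfl
  | cons b l ih =>
    rw [iterLieDeriv_cons, iterLieDeriv_cons, iterLieDeriv_cons, ← ih]
    congr 1
    simp only [LinearMap.add_apply, Ring.lie_def]; noncomm_ring

theorem iterLieDeriv_smul_map (c : ℂ) (a : 𝒜) (d : B) (l : List 𝒜) :
    iterLieDeriv (c • L) a (c • d) l = c • iterLieDeriv L a d l := by
  induction l generalizing a d with
  | nil => rfl
  | cons b l ih =>
    rw [iterLieDeriv_cons, iterLieDeriv_cons, ← ih]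
    congr 1
    simp [Ring.lie_def, smul_sub]

/-- Every entry of `l` contributes one more copy of the commutator. This count later excludes
multiples of the inclusion. -/
theorem iterLieDeriv_subtype (a : 𝒜) (c : ℂ) (l : List 𝒜) :
    iterLieDeriv 𝒜.val.toLinearMap a (c • (a : B)) l =
      (c + l.length) • ((iterLie a l : 𝒜) : B) := by
  induction l generalizing a c with
  | nil => simp
  | cons b l ih =>
    have h : ⁅c • (a : B), (b : B)⁆ + ⁅(a : B), 𝒜.val.toLinearMap b⁆ =
        (c + 1) • ((⁅a, b⁆ : 𝒜) : B) := by
      rw [coe_lie]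
      simp only [Ring.lie_def, AlgHom.toLinearMap_apply, Subalgebra.coe_val, add_smul,
        one_smul, smul_sub, smul_mul_assoc, mul_smul_comm]
      abel
    rw [iterLieDeriv_cons, h, ih, iterLie_cons]
    congr 1
    push_cast [List.length_cons]
    ring

theorem sum_p_update (n : ℕ) (x : Fin (n + 1) → 𝒜) :
    ∑ k : Fin (n + 1), p (n + 1) (Function.update (fun i => (x i : B)) k (L (x k))) =
      iterLieDeriv L (x 0) (L (x 0)) (List.ofFn (Fin.tail x)) := by
  induction n with
  | zero => simp [p]
  | succ n ih =>
    have h := ih (Fin.init x)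
    have h0 : Fin.init x 0 = x 0 := rfl
    have ht : (fun i : Fin n => Fin.tail x i.castSucc) = Fin.tail (Fin.init x) := rfl
    rw [List.ofFn_succ', List.concat_eq_append, iterLieDeriv_append, ht, ← h0, ← h,
      Fin.sum_univ_castSucc, iterLieDeriv_cons, iterLieDeriv_nil]
    have hl : Fin.tail x (Fin.last n) = x (Fin.last (n + 1)) := rfl
    rw [hl, Ring.lie_def, Finset.sum_mul, Finset.mul_sum, ← Finset.sum_sub_distrib]
    congr 1
    · refine Finset.sum_congr rfl fun k _ => ?_
      rw [p, Function.update_of_ne (Fin.castSucc_lt_last k).ne', Ring.lie_def]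
      have : (Fin.init (Function.update (fun i => (x i : B)) k.castSucc (L (x k.castSucc)))) =
          Function.update (fun i => ((Fin.init x) i : B)) k (L (Fin.init x k)) :=
        Fin.init_update_castSucc ..
      rw [this]
    · rw [p, Function.update_self, Fin.init_update_last, coe_iterLie, p_succ_eq_iterLie,
        List.map_ofFn]
      rfl

theorem isLieDerivation_iff (n : ℕ) (hn : 1 ≤ n) :
    IsLieDerivation n L ↔
      ∀ (a : 𝒜) (l : List 𝒜), l.length + 1 = n → L (iterLie a l) = iterLieDeriv L a (L a) l := by
  obtain ⟨n, rfl⟩ : ∃ m, n = m + 1 := ⟨n - 1, by omega⟩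
  constructor
  · rintro h a l hl
    obtain rfl : l.length = n := by omega
    have := h (Fin.cons a l.get)
    rw [p_succ_eq_iterLie, sum_p_update] at this
    simpa using this
  · intro h x
    rw [p_succ_eq_iterLie, sum_p_update]
    exact h _ _ (by simp)

variable {L}

theorem IsDerivation.map_lie {D : 𝒜 →ₗ[ℂ] B} (hD : IsDerivation D) (a b : 𝒜) :
    D ⁅a, b⁆ = ⁅D a, (b : B)⁆ + ⁅(a : B), D b⁆ := by
  rw [Ring.lie_def, map_sub, hD, hD, Ring.lie_def, Ring.lie_def]; abel

theorem IsDerivation.map_iterLie {D : 𝒜 →ₗ[ℂ] B} (hD : IsDerivation D) (a : 𝒜) (l : List 𝒜) :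
    D (iterLie a l) = iterLieDeriv D a (D a) l := by
  induction l generalizing a with
  | nil => rfl
  | cons b l ih => rw [iterLie_cons, ih, iterLieDeriv_cons, hD.map_lie]

theorem IsDerivation.isLieDerivation {D : 𝒜 →ₗ[ℂ] B} (hD : IsDerivation D) {n : ℕ} (hn : 1 ≤ n) :
    IsLieDerivation n D :=
  (isLieDerivation_iff D n hn).2 fun a l _ => hD.map_iterLie a l

theorem IsLieDerivation.add {L L' : 𝒜 →ₗ[ℂ] B} {n : ℕ} (hn : 1 ≤ n) (h : IsLieDerivation n L)
    (h' : IsLieDerivation n L') : IsLieDerivation n (L + L') := by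
  rw [isLieDerivation_iff _ n hn] at *
  intro a l hl
  rw [LinearMap.add_apply, LinearMap.add_apply, iterLieDeriv_add_map, h a l hl, h' a l hl]

theorem IsLieDerivation.smul {L : 𝒜 →ₗ[ℂ] B} {n : ℕ} (hn : 1 ≤ n) (h : IsLieDerivation n L)
    (c : ℂ) : IsLieDerivation n (c • L) := by
  rw [isLieDerivation_iff _ n hn] at *
  intro a l hl
  rw [LinearMap.smul_apply, LinearMap.smul_apply, iterLieDeriv_smul_map, h a l hl]

theorem IsLieDerivation.sub {L L' : 𝒜 →ₗ[ℂ] B} {n : ℕ} (hn : 1 ≤ n) (h : IsLieDerivation n L)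
    (h' : IsLieDerivation n L') : IsLieDerivation n (L - L') := by
  have := h.add hn (h'.smul hn (-1))
  rwa [show L + (-1 : ℂ) • L' = L - L' by module] at this

/-- The inner derivation `a ↦ [g, a]`. -/
def innerDerivation (𝒜 : Subalgebra ℂ B) (g : B) : 𝒜 →ₗ[ℂ] B :=
  (LinearMap.mulLeft ℂ g - LinearMap.mulRight ℂ g) ∘ₗ 𝒜.val.toLinearMap

theorem innerDerivation_apply (g : B) (a : 𝒜) : innerDerivation 𝒜 g a = g * a - a * g := by
  simp [innerDerivation]

theorem isDerivation_innerDerivation (g : B) : IsDerivation (innerDerivation 𝒜 g) := by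
  intro x y
  simp only [innerDerivation_apply, Subalgebra.coe_mul]
  noncomm_ring

theorem IsDerivation.add {D D' : 𝒜 →ₗ[ℂ] B} (h : IsDerivation D) (h' : IsDerivation D') :
    IsDerivation (D + D') := by
  intro x y
  simp only [LinearMap.add_apply, h x y, h' x y]
  noncomm_ring

theorem scalar_lie (c : ℂ) (b : B) : ⁅c • (1 : B), b⁆ = 0 := by
  simp [Ring.lie_def]

theorem lie_scalar (c : ℂ) (b : B) : ⁅b, c • (1 : B)⁆ = 0 := by
  simp [Ring.lie_def]

theorem iterLieDeriv_eq_zero_of_scalar {H : 𝒜 →ₗ[ℂ] B} (hH : ∀ x, ∃ c : ℂ, H x = c • (1 : B))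
    (a : 𝒜) (l : List 𝒜) (hl : l ≠ []) : iterLieDeriv H a (H a) l = 0 := by
  have key : ∀ (l : List 𝒜) (a : 𝒜), iterLieDeriv H a 0 l = 0 := by
    intro l
    induction l with
    | nil => intro; rfl
    | cons b l ih =>
      intro a
      obtain ⟨c, hc⟩ := hH b
      have h0 : ⁅(0 : B), (b : B)⁆ = 0 := by simp [Ring.lie_def]
      simpa [hc, lie_scalar, h0] using ih _
  cases l with
  | nil => exact absurd rfl hl
  | cons b l =>
    obtain ⟨c, hc⟩ := hH a
    obtain ⟨c', hc'⟩ := hH b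
    simpa [hc, hc', lie_scalar, scalar_lie] using key l _

theorem isLieDerivation_scalar_iff {H : 𝒜 →ₗ[ℂ] B} (hH : ∀ x, ∃ c : ℂ, H x = c • (1 : B))
    {n : ℕ} (hn : 2 ≤ n) : IsLieDerivation n H ↔ ∀ x : Fin n → 𝒜, H (p n x) = 0 := by
  obtain ⟨n, rfl⟩ : ∃ m, n = m + 2 := ⟨n - 2, by omega⟩
  refine forall_congr' fun x => ?_
  rw [sum_p_update, iterLieDeriv_eq_zero_of_scalar hH _ _ (by simp)]

theorem IsStandardForm.isLieDerivation {L D H : 𝒜 →ₗ[ℂ] B} {n : ℕ} (hn : 2 ≤ n)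
    (h : IsStandardForm n L D H) : IsLieDerivation n L := by
  rw [h.eq_add]
  exact (h.derivation.isLieDerivation (by omega)).add (by omega)
    ((isLieDerivation_scalar_iff h.scalar hn).2 h.vanish)

theorem IsLieDerivation.isStandardForm {L D H : 𝒜 →ₗ[ℂ] B} {n : ℕ} (hn : 2 ≤ n)
    (hL : IsLieDerivation n L) (hD : IsDerivation D) (hH : ∀ x, ∃ c : ℂ, H x = c • (1 : B))
    (h : L = D + H) : IsStandardForm n L D H where
  derivation := hD
  scalar := hH
  vanish := by
    refine (isLieDerivation_scalar_iff hH hn).1 ?_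
    have := hL.sub (by omega) (hD.isLieDerivation (n := n) (by omega))
    rwa [h, add_sub_cancel_left] at this
  eq_add := h

end Subalgebra

/-! ### Relations among commutators, and removal of the central term. -/

section Subalgebra

variable {B : Type*} [Ring B] [Algebra ℂ B] {𝒜 : Subalgebra ℂ B}

/-- Modulo scalars, `L` respects every linear relation among three commutators. -/
def RespectsCommutatorRelations (L : 𝒜 →ₗ[ℂ] B) : Prop :=
  ∀ a₁ b₁ a₂ b₂ a₃ b₃ : 𝒜, ⁅a₁, b₁⁆ + ⁅a₂, b₂⁆ + ⁅a₃, b₃⁆ = 0 →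
    ∃ s : ℂ, (⁅L a₁, (b₁ : B)⁆ + ⁅(a₁ : B), L b₁⁆) + (⁅L a₂, (b₂ : B)⁆ + ⁅(a₂ : B), L b₂⁆) +
      (⁅L a₃, (b₃ : B)⁆ + ⁅(a₃ : B), L b₃⁆) = s • (1 : B)

/-- An element of `B` is scalar as soon as all its commutators with `𝒜` are scalar. -/
def ScalarOfLieScalar (𝒜 : Subalgebra ℂ B) : Prop :=
  ∀ w : B, (∀ c : 𝒜, ∃ s : ℂ, ⁅w, (c : B)⁆ = s • (1 : B)) → ∃ s : ℂ, w = s • (1 : B)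

theorem ScalarOfLieScalar.iterLie (h : ScalarOfLieScalar 𝒜) (m : ℕ) (w : B)
    (hw : ∀ l : List 𝒜, l.length = m → ∃ s : ℂ, iterLie w (l.map (↑)) = s • (1 : B)) :
    ∃ s : ℂ, w = s • (1 : B) := by
  induction m generalizing w with
  | zero => exact hw [] rfl
  | succ m ih => exact h w fun c => ih _ fun l hl => hw (c :: l) (by simp [hl])

/-- Bracketing the relation with n − 2 further elements gives a relation among n-fold commutators,
where `L` obeys Leibniz. So all these iterated brackets of the defect vanish, and
`ScalarOfLieScalar` is applied n − 2 times. -/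
theorem IsLieDerivation.respectsCommutatorRelations (h : ScalarOfLieScalar 𝒜)
    {L : 𝒜 →ₗ[ℂ] B} {n : ℕ} (hn : 2 ≤ n) (hL : IsLieDerivation n L) :
    RespectsCommutatorRelations L := by
  intro a₁ b₁ a₂ b₂ a₃ b₃ h0
  rw [isLieDerivation_iff _ _ (by omega)] at hL
  refine h.iterLie (n - 2) _ fun l hl => ⟨0, ?_⟩
  have e : ∀ a b : 𝒜, L (NestLie.iterLie ⁅a, b⁆ l) =
      iterLieDeriv L ⁅a, b⁆ (⁅L a, (b : B)⁆ + ⁅(a : B), L b⁆) l := fun a b =>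
    hL a (b :: l) (by simp; omega)
  have add : ∀ a b : 𝒜, NestLie.iterLie (a + b) l = NestLie.iterLie a l + NestLie.iterLie b l := by
    clear e hl h0
    induction l with
    | nil => intros; rfl
    | cons c l ih =>
      intro a b
      rw [iterLie_cons, iterLie_cons, iterLie_cons, ← ih]
      congr 1
      simp only [Ring.lie_def]; noncomm_ring
  rw [← iterLieDeriv_zero_left L, ← h0, iterLieDeriv_add, iterLieDeriv_add, ← e, ← e, ← e,
    ← map_add, ← map_add, ← add, ← add, h0, iterLie_zero, map_zero, zero_smul]

theorem RespectsCommutatorRelations.sub_scalar {L : 𝒜 →ₗ[ℂ] B}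
    (hL : RespectsCommutatorRelations L) (h : 𝒜 →ₗ[ℂ] ℂ) :
    RespectsCommutatorRelations (L - h.smulRight (1 : B)) := by
  intro a₁ b₁ a₂ b₂ a₃ b₃ h0
  obtain ⟨s, hs⟩ := hL a₁ b₁ a₂ b₂ a₃ b₃ h0
  refine ⟨s, ?_⟩
  rw [← hs]
  have e : ∀ a b : 𝒜, ⁅(L - h.smulRight (1 : B)) a, (b : B)⁆ +
      ⁅(a : B), (L - h.smulRight (1 : B)) b⁆ = ⁅L a, (b : B)⁆ + ⁅(a : B), L b⁆ := by
    intro a b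
    simp [Ring.lie_def, sub_mul, mul_sub]
  rw [e, e, e]

/-- `L` is the sum of a derivation, a multiple of the inclusion and a scalar-valued map. -/
def IsDerivationModCentroid (L : 𝒜 →ₗ[ℂ] B) : Prop :=
  ∃ (D : 𝒜 →ₗ[ℂ] B) (k : ℂ) (h : 𝒜 →ₗ[ℂ] ℂ), IsDerivation D ∧
    L = D + k • 𝒜.val.toLinearMap + h.smulRight (1 : B)

theorem IsDerivationModCentroid.add {L D : 𝒜 →ₗ[ℂ] B} (hL : IsDerivationModCentroid L)
    (hD : IsDerivation D) : IsDerivationModCentroid (L + D) := by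
  obtain ⟨D', k, h, hD', rfl⟩ := hL
  exact ⟨D' + D, k, h, hD'.add hD, by abel⟩

/-- The difference of `L` and the derivation is again a Lie n-derivation. On p_n it gives k·p_n plus
a scalar, while Leibniz gives n·k·p_n. If k ≠ 0, every p_n is scalar, hence every element is. -/
theorem IsDerivationModCentroid.exists_isStandardForm (h : ScalarOfLieScalar 𝒜)
    (h𝒜 : ∃ a : 𝒜, ∀ s : ℂ, (a : B) ≠ s • (1 : B)) {L : 𝒜 →ₗ[ℂ] B}
    (hL' : IsDerivationModCentroid L) {n : ℕ} (hn : 2 ≤ n) (hL : IsLieDerivation n L) :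
    ∃ D H : 𝒜 →ₗ[ℂ] B, IsStandardForm n L D H := by
  obtain ⟨D, k, f, hD, hLD⟩ := hL'
  have hscal : ∀ x, ∃ c : ℂ, f.smulRight (1 : B) x = c • (1 : B) := fun x => ⟨f x, rfl⟩
  suffices hk : k = 0 by
    refine ⟨D, f.smulRight (1 : B), hL.isStandardForm hn hD hscal ?_⟩
    rw [hLD, hk, zero_smul, add_zero]
  by_contra hk
  have hdiff := hL.sub (by omega) (hD.isLieDerivation (n := n) (by omega))
  rw [hLD, add_assoc, add_sub_cancel_left, isLieDerivation_iff _ _ (by omega)] at hdiff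
  obtain ⟨a, ha⟩ := h𝒜
  obtain ⟨s, hs⟩ := h.iterLie (n - 1) (a : B) (by
    intro l hl
    have h1 := hdiff a l (by omega)
    have hl0 : l ≠ [] := by rintro rfl; simp at hl; omega
    have h2 := iterLieDeriv_subtype a 1 l
    rw [one_smul] at h2
    rw [LinearMap.add_apply, LinearMap.add_apply, iterLieDeriv_add_map,
      iterLieDeriv_eq_zero_of_scalar hscal _ _ hl0, LinearMap.smul_apply, LinearMap.smul_apply,
      iterLieDeriv_smul_map, AlgHom.toLinearMap_apply, AlgHom.toLinearMap_apply,
      Subalgebra.coe_val, h2, hl, add_zero] at h1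
    have hn1 : ((n - 1 : ℕ) : ℂ) ≠ 0 := Nat.cast_ne_zero.2 (by omega)
    refine ⟨(k * (n - 1 : ℕ))⁻¹ * f (NestLie.iterLie a l), ?_⟩
    rw [← coe_iterLie, mul_smul]
    rw [eq_inv_smul_iff₀ (mul_ne_zero hk hn1)]
    have h3 : f (NestLie.iterLie a l) • (1 : B) =
        k • (1 + ((n - 1 : ℕ) : ℂ)) • ((NestLie.iterLie a l : 𝒜) : B) -
          k • ((NestLie.iterLie a l : 𝒜) : B) := by
      rw [← h1]; simp
    rw [h3]
    module)
  exact ha s hs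

end Subalgebra

/-! ### Operators that commute with the algebra modulo scalars; automatic continuity. -/

section Operator

variable {X : Type*} [NormedAddCommGroup X] [NormedSpace ℂ X]

theorem lie_apply (S T : X →L[ℂ] X) (v : X) : ⁅S, T⁆ v = S (T v) - T (S v) := by
  simp [Ring.lie_def]

theorem exists_map_eq_one {x : X} (hx : x ≠ 0) : ∃ φ : X →L[ℂ] ℂ, φ x = 1 :=
  SeparatingDual.exists_eq_one hx

theorem exists_eq_one_of_ne_zero {f : X →L[ℂ] ℂ} (hf : f ≠ 0) : ∃ z, f z = 1 := by
  obtain ⟨z, hz⟩ : ∃ z, f z ≠ 0 := by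
    by_contra! h
    exact hf (ContinuousLinearMap.ext h)
  exact ⟨(f z)⁻¹ • z, by simp [hz]⟩

/-- If `F y` is a multiple of `G y` for every `y`, then `F` is a multiple of `G`. -/
theorem exists_eq_smul_of_forall {V W : Type*} [AddCommGroup V] [Module ℂ V] [AddCommGroup W]
    [Module ℂ W] {F G : V →ₗ[ℂ] W} (h : ∀ y, ∃ c : ℂ, F y = c • G y) :
    ∃ c : ℂ, ∀ y, F y = c • G y := by
  by_cases hG : ∀ y, G y = 0
  · refine ⟨0, fun y => ?_⟩
    obtain ⟨c, hc⟩ := h y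
    rw [hc, hG, smul_zero, smul_zero]
  push Not at hG
  obtain ⟨y₀, hy₀⟩ := hG
  obtain ⟨c₀, hc₀⟩ := h y₀
  refine ⟨c₀, fun y => ?_⟩
  by_cases hy : ∃ t : ℂ, G y = t • G y₀
  · obtain ⟨t, ht⟩ := hy
    obtain ⟨c, hc⟩ := h (y - t • y₀)
    rw [map_sub, map_sub, map_smul, map_smul, ht, sub_self, smul_zero, sub_eq_zero, hc₀] at hc
    rw [hc, ht, smul_comm]
  · push Not at hy
    obtain ⟨c, hc⟩ := h y
    obtain ⟨d, hd⟩ := h (y + y₀)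
    rw [map_add, map_add, hc, hc₀, smul_add] at hd
    have h1 : (c - d) • G y = (d - c₀) • G y₀ := by
      rw [sub_smul, sub_smul, sub_eq_sub_iff_add_eq_add, hd]; abel
    have hcd : c = d := by
      by_contra hne
      refine hy ((c - d)⁻¹ * (d - c₀)) ?_
      rw [mul_smul, ← h1, inv_smul_smul₀ (sub_ne_zero.2 hne)]
    rw [hcd, sub_self, zero_smul, eq_comm, smul_eq_zero, or_iff_left hy₀, sub_eq_zero] at h1
    rw [hc, hcd, h1]

variable {𝒜 : Subalgebra ℂ (X →L[ℂ] X)}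

/-- An operator algebra with a nonzero square-zero element and enough rank-one operators has the
scalars as its commutant, even modulo scalars. -/
theorem scalarOfLieScalar_of_dense {T : 𝒜} (hT : T ≠ 0) (hT2 : T * T = 0) {x₀ : X} (hx₀ : x₀ ≠ 0)
    (hd : Dense {y : X | ∃ f : X →L[ℂ] ℂ, f ≠ 0 ∧ f.smulRight y ∈ 𝒜 ∧ f.smulRight x₀ ∈ 𝒜}) :
    ScalarOfLieScalar 𝒜 := by
  intro w hw
  have hT' : (T : X →L[ℂ] X) ≠ 0 := fun h => hT (Subtype.ext h)
  have hT2' : (T : X →L[ℂ] X) * T = 0 := congrArg Subtype.val hT2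
  obtain ⟨v, hv⟩ : ∃ v, (T : X →L[ℂ] X) v ≠ 0 := by
    by_contra! h
    exact hT' (ContinuousLinearMap.ext h)
  have hTT : ∀ v, (T : X →L[ℂ] X) ((T : X →L[ℂ] X) v) = 0 := fun v => by
    simpa using congrArg (fun S : X →L[ℂ] X => S v) hT2'
  -- If [w, T] = s, then 0 = [w, T²] = 2sT.
  have hT0 : ⁅w, (T : X →L[ℂ] X)⁆ = 0 := by
    obtain ⟨s, hs⟩ := hw T
    have h1 : ⁅w, (T : X →L[ℂ] X)⁆ * T + T * ⁅w, (T : X →L[ℂ] X)⁆ = 0 := by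
      have : ⁅w, (T : X →L[ℂ] X)⁆ * T + T * ⁅w, (T : X →L[ℂ] X)⁆ =
        w * (T * T : X →L[ℂ] X) - (T * T) * w := by rw [Ring.lie_def]; noncomm_ring
      rw [this, hT2']; simp
    rw [hs] at h1 ⊢
    have h2 : (2 * s) • (T : X →L[ℂ] X) = 0 := by
      rw [← h1]; simp only [smul_mul_assoc, one_mul, mul_smul_comm, mul_one]; module
    rcases smul_eq_zero.1 h2 with h | h
    · rw [(by simpa using h : s = 0), zero_smul]
    · exact absurd h hT'
  -- Now [w, cT] = [w, c]T is both a scalar and a multiple of T, and T is nilpotent.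
  have hcomm : ∀ c : 𝒜, ⁅w, (c : X →L[ℂ] X)⁆ = 0 := by
    intro c
    obtain ⟨s, hs⟩ := hw c
    obtain ⟨t, ht⟩ := hw (c * T)
    have h1 : s • (T : X →L[ℂ] X) = t • 1 := by
      rw [← ht]
      have : ⁅w, ((c * T : 𝒜) : X →L[ℂ] X)⁆ =
          ⁅w, (c : X →L[ℂ] X)⁆ * T + c * ⁅w, (T : X →L[ℂ] X)⁆ := by
        rw [Subalgebra.coe_mul]; simp only [Ring.lie_def]; noncomm_ring
      rw [this, hT0, hs]; simp
    have h2 : t = 0 := by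
      have : (0 : X) = t • (T : X →L[ℂ] X) v := by
        simpa [hTT] using congrArg (fun S : X →L[ℂ] X => S ((T : X →L[ℂ] X) v)) h1
      exact (smul_eq_zero.1 this.symm).resolve_right hv
    rw [h2, zero_smul] at h1
    rcases smul_eq_zero.1 h1 with h | h
    · rw [hs, h, zero_smul]
    · exact absurd h hT'
  obtain ⟨φ, hφ⟩ := exists_map_eq_one hx₀
  refine ⟨φ (w x₀), ContinuousLinearMap.ext_on (hd.mono Submodule.subset_span) ?_⟩
  rintro y ⟨f, hf, hy, hx⟩
  obtain ⟨z, hz⟩ := exists_eq_one_of_ne_zero hf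
  -- The eigenvalue depends on `f` only, so `y` shares the eigenvalue of `x₀`.
  have key : ∀ u, f.smulRight u ∈ 𝒜 → w u = f (w z) • u := by
    intro u hu
    have := congrArg (fun S : X →L[ℂ] X => S z) (hcomm ⟨_, hu⟩)
    simpa [lie_apply, hz, sub_eq_zero] using this
  simp [key y hy, key x₀ hx, hφ]

/-- If `D + H` is continuous with `D` a derivation and `H` scalar-valued, then `D` and `H` are
continuous. -/
theorem IsStandardForm.continuous [CompleteSpace X] (hcl : IsClosed (𝒜 : Set (X →L[ℂ] X)))
    (h𝒜 : ∃ a : 𝒜, ∀ s : ℂ, (a : X →L[ℂ] X) ≠ s • (1 : X →L[ℂ] X)) {n : ℕ}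
    {L D H : 𝒜 →ₗ[ℂ] (X →L[ℂ] X)} (hL : Continuous L) (h : IsStandardForm n L D H) :
    Continuous D ∧ Continuous H := by
  have : CompleteSpace 𝒜 := hcl.completeSpace_coe
  have hHD : ∀ x, H x = L x - D x := fun x => by rw [h.eq_add]; simp
  have hrange : IsClosed ((Submodule.span ℂ {(1 : X →L[ℂ] X)} : Submodule ℂ (X →L[ℂ] X)) :
      Set (X →L[ℂ] X)) := Submodule.closed_of_finiteDimensional _
  have hmem : ∀ x, H x ∈ Submodule.span ℂ {(1 : X →L[ℂ] X)} := fun x => by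
    obtain ⟨c, hc⟩ := h.scalar x
    exact Submodule.mem_span_singleton.2 ⟨c, hc.symm⟩
  have hlim : ∀ (u : ℕ → 𝒜) (x : 𝒜) (y : X →L[ℂ] X), Filter.Tendsto u Filter.atTop (nhds x) →
      Filter.Tendsto (D ∘ u) Filter.atTop (nhds y) → ∃ c : ℂ, D x - y = c • (1 : X →L[ℂ] X) := by
    intro u x y hu hy
    have h1 : Filter.Tendsto (fun k => H (u k)) Filter.atTop (nhds (L x - y)) := by
      simp only [hHD]
      exact ((hL.tendsto x).comp hu).sub hy
    have h2 := hrange.mem_of_tendsto h1 (Filter.Eventually.of_forall fun k => hmem (u k))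
    have h3 := Submodule.sub_mem _ h2 (hmem x)
    rw [hHD, sub_sub_sub_cancel_left] at h3
    obtain ⟨c, hc⟩ := Submodule.mem_span_singleton.1 h3
    exact ⟨c, hc.symm⟩
  -- In the closed graph criterion the defect D x − y is a scalar c, being a limit of values of H up
  -- to sign and shift. The sequence u k * b has defect c • b, also scalar; `b` is not, so c = 0.
  have hD : Continuous D := by
    refine LinearMap.continuous_of_seq_closed_graph D fun u x y hu hy => ?_
    obtain ⟨b, hb⟩ := h𝒜
    obtain ⟨c, hc⟩ := hlim u x y hu hy
    obtain ⟨d, hd⟩ := hlim (fun k => u k * b) (x * b) (y * b + x * D b) (hu.mul_const b) (by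
      have : (D ∘ fun k => u k * b) = fun k => D (u k) * (b : X →L[ℂ] X) + u k * D b :=
        funext fun k => h.derivation _ _
      rw [this]
      exact (hy.mul_const _).add (((continuous_subtype_val.tendsto x).comp hu).mul_const _))
    have h1 : c • (b : X →L[ℂ] X) = d • 1 := by
      rw [← hd, h.derivation, add_sub_add_right_eq_sub, ← sub_mul, hc, smul_mul_assoc, one_mul]
    have h2 : c = 0 := by
      by_contra hne
      refine hb (c⁻¹ * d) ?_
      rw [mul_smul, ← h1, inv_smul_smul₀ hne]
    rw [h2, zero_smul, sub_eq_zero] at hc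
    exact hc.symm
  refine ⟨hD, ?_⟩
  have : (H : 𝒜 → X →L[ℂ] X) = fun x => L x - D x := funext hHD
  rw [this]
  exact hL.sub hD

end Operator

/-! ### First case: all f⊗u lie in the algebra for one fixed f ≠ 0. -/

section IdealOfRankOnes

variable {X : Type*} [NormedAddCommGroup X] [NormedSpace ℂ X] {𝒜 : Subalgebra ℂ (X →L[ℂ] X)}
  {f : X →L[ℂ] ℂ}

/-- The rank-one operators `v ↦ f v • u`, as a linear function of `u` into the algebra. -/
noncomputable def rankOne (h : ∀ u, f.smulRight u ∈ 𝒜) : X →ₗ[ℂ] 𝒜 where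
  toFun u := ⟨f.smulRight u, h u⟩
  map_add' u v := Subtype.ext (ContinuousLinearMap.ext fun w => by simp)
  map_smul' c u := Subtype.ext (ContinuousLinearMap.ext fun w => by simp [smul_smul, mul_comm])

variable (h𝒜 : ∀ u, f.smulRight u ∈ 𝒜)

@[simp] theorem coe_rankOne (u : X) : (rankOne h𝒜 u : X →L[ℂ] X) = f.smulRight u := rfl

theorem subalgebra_ext {S T : 𝒜} (h : ∀ v, (S : X →L[ℂ] X) v = (T : X →L[ℂ] X) v) : S = T :=
  Subtype.ext (ContinuousLinearMap.ext h)

variable {e : X} (he : f e = 1)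
include he

/-- In X = ℂe ⊕ ker f, bracketing with f⊗e kills the diagonal blocks, fixes the column ℂe → ker f
and negates the row ker f → ℂe. -/
theorem iterLie_replicate_apply (W : X →L[ℂ] X) (m : ℕ) :
    iterLie W (List.replicate (m + 1) (f.smulRight e)) e = W e - f (W e) • e ∧
      ∀ u, f u = 0 → iterLie W (List.replicate (m + 1) (f.smulRight e)) u =
        ((-1) ^ (m + 1) * f (W u)) • e := by
  induction m generalizing W with
  | zero =>
    refine ⟨by simp [lie_apply, he], fun u hu => by simp [lie_apply, hu]⟩
  | succ m ih =>
    rw [List.replicate_succ, iterLie_cons]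
    refine ⟨?_, fun u hu => ?_⟩
    · rw [(ih _).1]
      simp [lie_apply, he]
    · rw [(ih _).2 u hu]
      simp only [lie_apply, ContinuousLinearMap.smulRight_apply, hu, zero_smul, map_zero, zero_sub,
        map_neg, map_smul, he, smul_eq_mul, mul_one]
      congr 1
      ring

theorem iterLie_rankOne (u : X) (hu : f u = 0) (m : ℕ) :
    iterLie (f.smulRight u) (List.replicate m (f.smulRight e)) = f.smulRight u := by
  induction m with
  | zero => rfl
  | succ m ih =>
    have : ⁅f.smulRight u, f.smulRight e⁆ = f.smulRight u := by
      ext v; simp [lie_apply, he, hu]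
    rw [List.replicate_succ, iterLie_cons, this, ih]

theorem iterLie_rankOne' (u : X) (hu : f u = 0) (m : ℕ) :
    iterLie (rankOne h𝒜 u) (List.replicate m (rankOne h𝒜 e)) = rankOne h𝒜 u := by
  apply Subtype.ext
  rw [coe_iterLie, List.map_replicate]
  exact iterLie_rankOne he u hu m

omit he in
theorem iterLie_replicate_of_lie_eq_neg {R : Type*} [Ring R] [Algebra ℂ R] {S Q : R}
    (h : ⁅S, Q⁆ = -S) (m : ℕ) : iterLie S (List.replicate m Q) = (-1 : ℂ) ^ m • S := by
  have key : ∀ (m : ℕ) (t : ℂ), iterLie (t • S) (List.replicate m Q) = ((-1) ^ m * t) • S := by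
    intro m
    induction m with
    | zero => simp
    | succ m ih =>
      intro t
      have h' : ⁅t • S, Q⁆ = (-t) • S := by
        rw [neg_smul, ← smul_neg, ← h, Ring.lie_def, Ring.lie_def, smul_sub, smul_mul_assoc,
          mul_smul_comm]
      rw [List.replicate_succ, iterLie_cons, h', ih]
      congr 1
      ring
  simpa using key m 1

omit he in
theorem neg_lie_self_eq_zero {R : Type*} [Ring R] (a : R) : ⁅-a, a⁆ = 0 := by
  simp [Ring.lie_def]

/-- If `L` of the rank-one idempotent commutes with it, then it is scalar. -/
theorem IsLieDerivation.map_rankOne_eq_scalar {L : 𝒜 →ₗ[ℂ] (X →L[ℂ] X)} {n : ℕ} (hn : 2 ≤ n)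
    (hL : IsLieDerivation n L) (hQ : ⁅L (rankOne h𝒜 e), f.smulRight e⁆ = 0) :
    ∃ c : ℂ, L (rankOne h𝒜 e) = c • (1 : X →L[ℂ] X) := by
  set R := L (rankOne h𝒜 e) with hR
  have hv : ∀ v, f v • R e = f (R v) • e := fun v => by
    have := congrArg (fun S : X →L[ℂ] X => S v) hQ
    simpa [lie_apply, sub_eq_zero] using this
  have hRe : R e = f (R e) • e := by simpa [he] using hv e
  have hfR : ∀ v, f (R v) = f (R e) * f v := fun v => by
    have := congrArg f (hv v)
    simp only [map_smul, smul_eq_mul, he, mul_one] at this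
    rw [← this, mul_comm]
  have hker : ∀ u, f u = 0 → R u = f (R e) • u := by
    intro u hu
    -- Each slot filled with Q adds f(Re)u − Ru to the column block. As p_n(f⊗u, Q, …, Q) = f⊗u, the
    -- n − 1 contributions must sum to zero.
    have key : ∀ (m : ℕ) (d : X →L[ℂ] X),
        (fun W : X →L[ℂ] X => W e - f (W e) • e)
          (iterLieDeriv L (rankOne h𝒜 u) d (List.replicate m (rankOne h𝒜 e))) =
        d e - f (d e) • e + (m : ℂ) • (f (R e) • u - R u) := by
      intro m
      induction m with
      | zero => intro d; simp
      | succ m ih =>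
        intro d
        have h1 : ⁅rankOne h𝒜 u, rankOne h𝒜 e⁆ = rankOne h𝒜 u := by
          simpa using iterLie_rankOne' h𝒜 he u hu 1
        rw [List.replicate_succ, iterLieDeriv_cons, h1, ih]
        simp only [add_apply, lie_apply, coe_rankOne,
          ContinuousLinearMap.smulRight_apply, he, one_smul, map_add, map_sub, map_smul, smul_eq_mul,
          mul_one, hu, mul_zero, ← hR, hfR u]
        push_cast
        module
    rw [isLieDerivation_iff _ _ (by omega)] at hL
    have h1 := hL (rankOne h𝒜 u) (List.replicate (n - 1) (rankOne h𝒜 e)) (by simp; omega)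
    rw [iterLie_rankOne' h𝒜 he u hu] at h1
    have h2 := key (n - 1) (L (rankOne h𝒜 u))
    rw [← h1, left_eq_add, smul_eq_zero, sub_eq_zero] at h2
    exact (h2.resolve_left (Nat.cast_ne_zero.2 (by omega))).symm
  refine ⟨f (R e), ContinuousLinearMap.ext fun v => ?_⟩
  have h1 := hker (v - f v • e) (by simp [he])
  rw [map_sub, map_smul, hRe] at h1
  simp only [map_smul, he, smul_eq_mul, mul_one] at h1
  simp only [smul_apply, one_apply_eq_self]
  linear_combination (norm := module) h1

variable {L : 𝒜 →ₗ[ℂ] (X →L[ℂ] X)} {m : ℕ} (hL : IsLieDerivation (m + 2) L) {c : ℂ}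
  (hQ : L (rankOne h𝒜 e) = c • (1 : X →L[ℂ] X))

omit he in
theorem iterLieDeriv_replicate (hQ : L (rankOne h𝒜 e) = c • (1 : X →L[ℂ] X)) (a : 𝒜)
    (d : X →L[ℂ] X) (k : ℕ) :
    iterLieDeriv L a d (List.replicate k (rankOne h𝒜 e)) =
      iterLie d (List.replicate k (f.smulRight e)) := by
  induction k generalizing a d with
  | zero => rfl
  | succ k ih =>
    rw [List.replicate_succ, List.replicate_succ, iterLieDeriv_cons, iterLie_cons, hQ, lie_scalar,
      add_zero, ih, coe_rankOne]

include hL hQ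

-- Since L(Q) is scalar, slots filled with Q are not differentiated, and the n-fold Leibniz rule
-- reduces to a two-fold one.
omit he in
theorem map_lie_iterLie_replicate (a b : 𝒜) :
    L ⁅iterLie a (List.replicate m (rankOne h𝒜 e)), b⁆ =
      ⁅iterLie (L a) (List.replicate m (f.smulRight e)), (b : X →L[ℂ] X)⁆ +
        ⁅((iterLie a (List.replicate m (rankOne h𝒜 e)) : 𝒜) : X →L[ℂ] X), L b⁆ := by
  rw [isLieDerivation_iff _ _ (by omega)] at hL
  have := hL a (List.replicate m (rankOne h𝒜 e) ++ [b]) (by simp)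
  rwa [iterLie_append, iterLieDeriv_append, iterLieDeriv_replicate h𝒜 hQ] at this

omit he in
theorem map_iterLie_replicate (a : 𝒜) :
    L (iterLie a (List.replicate (m + 1) (rankOne h𝒜 e))) =
      iterLie (L a) (List.replicate (m + 1) (f.smulRight e)) := by
  rw [isLieDerivation_iff _ _ (by omega)] at hL
  rw [hL _ _ (by simp), iterLieDeriv_replicate h𝒜 hQ]

theorem map_rankOne_of_ker {u : X} (hu : f u = 0) :
    f (L (rankOne h𝒜 u) e) = 0 ∧ L (rankOne h𝒜 u) = f.smulRight (L (rankOne h𝒜 u) e) := by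
  set W := L (rankOne h𝒜 u) with hW
  have h1 := map_iterLie_replicate h𝒜 hL hQ (rankOne h𝒜 u)
  rw [iterLie_rankOne' h𝒜 he u hu, ← hW] at h1
  obtain ⟨h2, h3⟩ := iterLie_replicate_apply he W m
  rw [← h1] at h2 h3
  have hfWe : f (W e) = 0 := by
    have := congrArg f h2
    simpa [he] using this
  have hker : ∀ v, f v = 0 → f (W v) = 0 := by
    intro v hv
    have h4 := congrArg f (h3 v hv)
    rw [map_smul, he, smul_eq_mul, mul_one] at h4
    -- For odd m + 1 the sign forces f(Wv) = −f(Wv). For even m + 1 that identity is empty, and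
    -- [f⊗u, f⊗u] = 0 is differentiated instead.
    rcases Nat.even_or_odd (m + 1) with hm | hm
    · obtain ⟨k, rfl⟩ : ∃ k, m = k + 1 := by
        cases m with
        | zero => simp at hm
        | succ k => exact ⟨k, rfl⟩
      have hk : (-1 : ℂ) ^ (k + 1) = -1 := Odd.neg_one_pow (by
        rcases Nat.even_or_odd (k + 1) with h | h
        · exact absurd hm (by simpa [Nat.even_add_one] using h)
        · exact h)
      have h5 := map_lie_iterLie_replicate h𝒜 hL hQ (rankOne h𝒜 u) (rankOne h𝒜 u)
      rw [iterLie_rankOne' h𝒜 he u hu, ← hW] at h5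
      have h6 : ⁅rankOne h𝒜 u, rankOne h𝒜 u⁆ = 0 := by simp [Ring.lie_def]
      rw [h6, map_zero] at h5
      have h7 := congrArg (fun S : X →L[ℂ] X => S v) h5
      simp only [zero_apply, add_apply, lie_apply,
        coe_rankOne, ContinuousLinearMap.smulRight_apply, hv, zero_smul, map_zero,
        (iterLie_replicate_apply he W k).2 v hv, hk, map_smul, he] at h7
      have h8 : (2 * f (W v)) • u = 0 := by
        linear_combination (norm := module) (-1 : ℂ) • h7
      rcases smul_eq_zero.1 h8 with h | h
      · simpa using h
      · rw [hW, h]; simp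
    · rw [hm.neg_one_pow] at h4
      linear_combination h4 / 2
  refine ⟨hfWe, ContinuousLinearMap.ext fun v => ?_⟩
  have h5 := h3 (v - f v • e) (by simp [he])
  rw [hker _ (by simp [he]), mul_zero, zero_smul, map_sub, map_smul, sub_eq_zero] at h5
  exact h5

theorem map_lie_rankOne {u : X} (hu : f u = 0) (b : 𝒜) :
    L ⁅rankOne h𝒜 u, b⁆ =
      ⁅f.smulRight (L (rankOne h𝒜 u) e), (b : X →L[ℂ] X)⁆ + ⁅f.smulRight u, L b⁆ := by
  obtain ⟨h1, h2⟩ := map_rankOne_of_ker h𝒜 he hL hQ hu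
  have := map_lie_iterLie_replicate h𝒜 hL hQ (rankOne h𝒜 u) b
  rw [iterLie_rankOne' h𝒜 he u hu] at this
  rw [this, h2, iterLie_rankOne he _ h1]
  simp [he]

theorem map_apply_of_apply_eq_zero {b : 𝒜} (hb : (b : X →L[ℂ] X) e = 0)
    (hb' : ∀ v, f ((b : X →L[ℂ] X) v) = 0) : L b e = f (L b e) • e := by
  have h0 : ⁅b, rankOne h𝒜 e⁆ = 0 := by
    refine subalgebra_ext fun v => ?_
    rw [coe_lie, lie_apply]
    simp [hb, hb']
  have h1 := map_iterLie_replicate h𝒜 hL hQ b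
  have h3 : iterLie b (List.replicate (m + 1) (rankOne h𝒜 e)) = 0 := by
    rw [List.replicate_succ, iterLie_cons, h0, iterLie_zero]
  rw [h3, map_zero] at h1
  have h2 := (iterLie_replicate_apply he (L b) m).1
  rw [← h1] at h2
  exact (sub_eq_zero.1 h2.symm)

variable {S : 𝒜} {h : X →L[ℂ] ℂ} (hS : ∀ v, (S : X →L[ℂ] X) v = h v • e) (hh : h e = 0)
include hS hh

/-- Only χ = f(L(B)e), with B = h⊗u, is unknown. Differentiating [f⊗u, S] = B − h(u)Q and [f⊗u, B] =
−h(u) f⊗u gives χ − h(u)c equal to both plus and minus the same quantity. -/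
theorem map_rankOne_mul_apply {u : X} (hu : f u = 0) (hu0 : u ≠ 0) :
    L (rankOne h𝒜 u * S) e = (h u * c) • e := by
  have hB : ∀ v, ((rankOne h𝒜 u * S : 𝒜) : X →L[ℂ] X) v = h v • u := fun v => by
    simp [hS, he]
  set B := rankOne h𝒜 u * S with hBdef
  set s := L (rankOne h𝒜 u) e with hs
  have h1 := map_apply_of_apply_eq_zero h𝒜 he hL hQ (b := B) (by simp [hB, hh])
    (by simp [hB, hu])
  have hTS : ⁅rankOne h𝒜 u, S⁆ = B - h u • rankOne h𝒜 e := by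
    refine subalgebra_ext fun v => ?_
    rw [coe_lie, lie_apply]
    simp [hB, hS, he, smul_smul, mul_comm]
  have hTB : ⁅rankOne h𝒜 u, B⁆ = -(h u • rankOne h𝒜 u) := by
    refine subalgebra_ext fun v => ?_
    rw [coe_lie, lie_apply]
    simp [hB, hu, smul_smul, mul_comm]
  have h2 := map_lie_rankOne h𝒜 he hL hQ hu S
  have h3 := map_lie_rankOne h𝒜 he hL hQ hu B
  rw [hTS, map_sub, map_smul, hQ] at h2
  rw [hTB, map_neg, map_smul] at h3
  have h2e := congrArg (fun W : X →L[ℂ] X => f (W e)) h2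
  have h2u := congrArg (fun W : X →L[ℂ] X => W u) h2
  have h3e := congrArg (fun W : X →L[ℂ] X => W e) h3
  simp only [sub_apply, smul_apply,
    one_apply_eq_self, add_apply, lie_apply,
    ContinuousLinearMap.smulRight_apply, hS, he, hu, hh, map_sub, map_add, map_smul, smul_eq_mul,
    mul_one, mul_zero, zero_smul, map_zero, map_neg, one_smul, zero_sub] at h2e
  simp only [sub_apply, smul_apply,
    one_apply_eq_self, add_apply, lie_apply,
    ContinuousLinearMap.smulRight_apply, hS, he, hu, map_smul, zero_smul, map_zero, sub_zero] at h2u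
  simp only [neg_apply, smul_apply,
    add_apply, lie_apply, ContinuousLinearMap.smulRight_apply, hB, hh, he,
    zero_smul, map_zero, one_smul, zero_sub, ← hs] at h3e
  set χ := f (L B e) with hχ
  have hLBu : L B u = h u • s - h s • u + χ • u := by
    linear_combination (norm := module) h3e
  rw [hLBu, ← sub_eq_zero] at h2u
  have h4 : (χ - h u * c - (f (L S u) + h s)) • u = 0 := by
    rw [← h2u]; module
  have h5 := (smul_eq_zero.1 h4).resolve_right hu0
  have h6 : χ = h u * c := by linear_combination (h5 + h2e) / 2
  rw [h1, h6]

/-- Bracketing with Q negates S but fixes the column of L(S), which settles odd m + 1. For even m +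
1, [S, S] = 0 is differentiated and evaluated where h ≠ 0. -/
theorem map_apply_eq_zero_of_range : L S e = 0 := by
  by_cases h0 : ∀ u, f u = 0 → h u = 0
  · have : S = 0 := subalgebra_ext fun v => by
      have h1 := h0 (v - f v • e) (by simp [he])
      rw [map_sub, map_smul, hh, smul_zero, sub_zero] at h1
      simp [hS, h1]
    rw [this, map_zero, zero_apply]
  push Not at h0
  obtain ⟨u, hu, hhu⟩ := h0
  have hSQ : ⁅S, rankOne h𝒜 e⁆ = -S := by
    refine subalgebra_ext fun v => ?_
    rw [coe_lie, lie_apply]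
    simp [hS, hh, he]
  set W := L S with hW
  have h1 := map_iterLie_replicate h𝒜 hL hQ S
  rw [iterLie_replicate_of_lie_eq_neg hSQ, ← hW] at h1
  have h2 := (iterLie_replicate_apply he W m).1
  rw [← h1] at h2
  rcases Nat.even_or_odd (m + 1) with hm | hm
  · obtain ⟨k, rfl⟩ : ∃ k, m = k + 1 := by
      cases m with
      | zero => simp at hm
      | succ k => exact ⟨k, rfl⟩
    have hk : Odd (k + 1) := by
      rcases Nat.even_or_odd (k + 1) with h | h
      · exact absurd hm (by simpa [Nat.even_add_one] using h)
      · exact h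
    rw [hm.neg_one_pow, one_smul, ← hW] at h2
    have hfWe : f (W e) = 0 := by
      have := congrArg f h2
      simpa [he] using this
    have h3 := map_lie_iterLie_replicate h𝒜 hL hQ S S
    rw [iterLie_replicate_of_lie_eq_neg hSQ, hk.neg_one_pow, neg_one_smul,
      neg_lie_self_eq_zero, map_zero, ← hW] at h3
    have h4 := congrArg (fun V : X →L[ℂ] X => V u) h3
    simp only [zero_apply, add_apply, lie_apply,
      Subalgebra.coe_neg, neg_apply, hS, map_smul, map_neg,
      (iterLie_replicate_apply he W k).2 u hu, (iterLie_replicate_apply he W k).1, hfWe, hh,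
      zero_smul, sub_zero, smul_eq_mul, mul_zero] at h4
    have h5 : h (W u) = 0 := by
      have := congrArg f h4
      simpa [hfWe, he] using this
    rw [h5] at h4
    have h6 : (2 * h u) • W e = 0 := by rw [h4]; module
    exact (smul_eq_zero.1 h6).resolve_left (by simpa using hhu)
  · rw [hm.neg_one_pow, neg_one_smul, map_neg, ← hW, neg_apply] at h2
    have hfWe : f (W e) = 0 := by
      have := congrArg f h2
      simpa [he] using this
    rw [hfWe, zero_smul, sub_zero] at h2
    have h6 : (2 : ℂ) • W e = 0 := by linear_combination (norm := module) -h2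
    exact (smul_eq_zero.1 h6).resolve_left two_ne_zero

omit hL hQ hS hh in
/-- If all rank-one operators `v ↦ f v • u` lie in `𝒜`, and `L` maps the idempotent one to a
scalar, then `L` is a derivation up to scalars. -/
theorem isDerivationModCentroid_of_map_idempotent
    (hL : IsLieDerivation (m + 2) L) (hQ : L (rankOne h𝒜 e) = c • (1 : X →L[ℂ] X)) :
    IsDerivationModCentroid L := by
  have hfe : ∀ v, f (v - f v • e) = 0 := fun v => by simp [he]
  -- If L were A ↦ σA − Aσ with σe = 0, then L(f⊗u)e = σu for u in ker f; this dictates σ.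
  let σ : X →ₗ[ℂ] X :=
    { toFun := fun v => L (rankOne h𝒜 (v - f v • e)) e
      map_add' := fun v w => by
        rw [← add_apply, ← map_add, ← map_add, map_add]
        congr 4
        module
      map_smul' := fun t v => by
        rw [RingHom.id_apply, ← smul_apply, ← map_smul, ← map_smul, map_smul, smul_sub, smul_smul,
          smul_eq_mul] }
  have hσ : ∀ v, σ v = L (rankOne h𝒜 (v - f v • e)) e := fun _ => rfl
  have hσu : ∀ u, f u = 0 → σ u = L (rankOne h𝒜 u) e := fun u hu => by
    rw [hσ, hu, zero_smul, sub_zero]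
  have hσe : σ e = 0 := by rw [hσ, he, one_smul, sub_self]; simp
  have hσL : ∀ v, L (rankOne h𝒜 v) e = σ v + (f v * c) • e := fun v => by
    rw [hσ, map_sub, map_smul, map_sub, map_smul, hQ]
    simp [smul_smul]
  let g : 𝒜 → X →L[ℂ] ℂ := fun A => f.comp (A : X →L[ℂ] X) - f ((A : X →L[ℂ] X) e) • f
  let S : 𝒜 → 𝒜 := fun A => rankOne h𝒜 e * A - f ((A : X →L[ℂ] X) e) • rankOne h𝒜 e
  have hS : ∀ (A : 𝒜) v, (S A : X →L[ℂ] X) v = g A v • e := fun A v => by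
    simp [S, g, sub_smul, smul_smul]
  have hg : ∀ A : 𝒜, g A e = 0 := fun A => by simp [g, he]
  have hkerL : ∀ (A : 𝒜) (u : X), f u = 0 →
      L A u = σ ((A : X →L[ℂ] X) u) - (A : X →L[ℂ] X) (σ u) + f (L A e) • u := by
    intro A u hu
    rcases eq_or_ne u 0 with rfl | hu0
    · simp
    have h1 := map_lie_rankOne h𝒜 he hL hQ hu A
    have h2 : ⁅rankOne h𝒜 u, A⁆ = rankOne h𝒜 u * S A + f ((A : X →L[ℂ] X) e) • rankOne h𝒜 u -
        rankOne h𝒜 ((A : X →L[ℂ] X) u) := by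
      refine subalgebra_ext fun v => ?_
      rw [coe_lie, lie_apply]
      simp [hS, he, g, sub_smul, smul_smul]
    rw [h2, map_sub, map_add, map_smul] at h1
    have h3 := congrArg (fun W : X →L[ℂ] X => W e) h1
    simp only [sub_apply, add_apply, smul_apply, lie_apply, ContinuousLinearMap.smulRight_apply,
      map_rankOne_mul_apply h𝒜 he hL hQ (hS A) (hg A) hu hu0, hσL, hu, he, one_smul,
      zero_mul, zero_smul, add_zero] at h3
    have h4 : g A u = f ((A : X →L[ℂ] X) u) := by simp [g, hu]
    rw [h4] at h3
    linear_combination (norm := module) h3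
  have heL : ∀ A : 𝒜, L A e = σ ((A : X →L[ℂ] X) e) + f (L A e) • e := by
    intro A
    -- Now B e = 0, so iterated brackets of B with Q see only the row block `S A`.
    set B := A - rankOne h𝒜 ((A : X →L[ℂ] X) e) with hB
    have h0 : L B e = f (L B e) • e := by
      have h1 : ⁅B, rankOne h𝒜 e⁆ = -S A := by
        refine subalgebra_ext fun v => ?_
        rw [coe_lie, lie_apply]
        simp [hB, hS, he, g, sub_smul, mul_comm]
      have hSQ : ⁅S A, rankOne h𝒜 e⁆ = -S A := by
        refine subalgebra_ext fun v => ?_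
        rw [coe_lie, lie_apply]
        simp [hS, hg, he]
      have h2 : iterLie B (List.replicate (m + 1) (rankOne h𝒜 e)) = (-1 : ℂ) ^ (m + 1) • S A := by
        rw [← iterLie_replicate_of_lie_eq_neg hSQ, List.replicate_succ, iterLie_cons, iterLie_cons,
          h1, hSQ]
      have h3 := map_iterLie_replicate h𝒜 hL hQ B
      rw [h2, map_smul] at h3
      have h4 := (iterLie_replicate_apply he (L B) m).1
      rw [← h3, smul_apply, map_apply_eq_zero_of_range h𝒜 he hL hQ (hS A) (hg A),
        smul_zero] at h4
      exact sub_eq_zero.1 h4.symm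
    have h5 : A = B + rankOne h𝒜 ((A : X →L[ℂ] X) e) := by rw [hB]; abel
    have h6 : L A e = L B e + L (rankOne h𝒜 ((A : X →L[ℂ] X) e)) e := by
      conv_lhs => rw [h5]
      rw [map_add, add_apply]
    have h7 : f (σ ((A : X →L[ℂ] X) e)) = 0 := by
      rw [hσ]
      exact (map_rankOne_of_ker h𝒜 he hL hQ (hfe _)).1
    rw [h6, hσL, h0]
    simp only [map_add, map_smul, h7, he, smul_eq_mul]
    module
  have hall : ∀ (A : 𝒜) (v : X),
      L A v = σ ((A : X →L[ℂ] X) v) - (A : X →L[ℂ] X) (σ v) + f (L A e) • v := by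
    intro A v
    have h1 := hkerL A (v - f v • e) (hfe v)
    have h2 := heL A
    simp only [map_sub, map_smul, hσe, smul_zero, sub_zero] at h1
    linear_combination (norm := module) h1 + f v • h2
  let H : 𝒜 →ₗ[ℂ] ℂ :=
    { toFun := fun A => f (L A e)
      map_add' := fun A B => by simp
      map_smul' := fun t A => by simp }
  refine ⟨L - H.smulRight 1, 0, H, ?_, by simp⟩
  have hD : ∀ (A : 𝒜) (v : X), (L - H.smulRight (1 : X →L[ℂ] X)) A v =
      σ ((A : X →L[ℂ] X) v) - (A : X →L[ℂ] X) (σ v) := by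
    intro A v
    rw [LinearMap.sub_apply, sub_apply, hall A v]
    simp [H]
  intro A B
  ext v
  simp only [add_apply, mul_apply_eq_comp, hD, Subalgebra.coe_mul, map_sub]
  abel

include h𝒜 in
omit hL hQ hS hh in
/-- If all rank-one operators `v ↦ f v • u` lie in `𝒜`, then a Lie `n`-derivation is a derivation
up to scalars. -/
theorem IsLieDerivation.isDerivationModCentroid_of_rankOne {n : ℕ} (hn : 2 ≤ n)
    (hL : IsLieDerivation n L) : IsDerivationModCentroid L := by
  obtain ⟨m, rfl⟩ : ∃ m, n = m + 2 := ⟨n - 2, by omega⟩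
  set q : X →L[ℂ] X := f.smulRight e with hq
  have hqq : q * q = q := by ext v; simp [hq, he]
  set R := L (rankOne h𝒜 e) with hR
  -- [[R, q], q] is the off-diagonal part of R relative to q, so subtracting it leaves something
  -- that commutes with q.
  set D := innerDerivation 𝒜 (R * q - q * R) with hD
  have hL' := hL.sub (by omega) ((isDerivation_innerDerivation (𝒜 := 𝒜)
    (R * q - q * R)).isLieDerivation (n := m + 2) (by omega))
  rw [← hD] at hL'
  have hQ : ⁅(L - D) (rankOne h𝒜 e), q⁆ = 0 := by
    rw [LinearMap.sub_apply, ← hR, hD, innerDerivation_apply, coe_rankOne, ← hq, Ring.lie_def]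
    have h1 : (R - ((R * q - q * R) * q - q * (R * q - q * R))) * q -
        q * (R - ((R * q - q * R) * q - q * (R * q - q * R))) =
        R * q - R * (q * q) * q + q * R * (q * q) + q * R * (q * q) - (q * q) * R * q - q * R
         + q * R * (q * q) - (q * q) * R * q - (q * q) * R * q + (q * q) * q * R := by
      noncomm_ring
    rw [h1]
    simp only [hqq, mul_assoc]
    abel
  obtain ⟨c, hc⟩ := hL'.map_rankOne_eq_scalar h𝒜 he (by omega) hQ
  have := (isDerivationModCentroid_of_map_idempotent h𝒜 he hL' hc).add
    (isDerivation_innerDerivation (𝒜 := 𝒜) (R * q - q * R))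
  rwa [← hD, sub_add_cancel] at this

end IdealOfRankOnes

/-! ### Finite-rank operators and annihilating functionals. -/

section FiniteRank

variable {X : Type*} [NormedAddCommGroup X] [NormedSpace ℂ X]

theorem smulRight_mul (f : X →L[ℂ] ℂ) (x : X) (S : X →L[ℂ] X) :
    f.smulRight x * S = (f.comp S).smulRight x := by
  ext; simp

theorem mul_smulRight (f : X →L[ℂ] ℂ) (x : X) (S : X →L[ℂ] X) :
    S * f.smulRight x = f.smulRight (S x) := by
  ext; simp

variable (X) in
/-- The operators of finite rank. -/
def finiteRank : Submodule ℂ (X →L[ℂ] X) :=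
  Submodule.span ℂ {W | ∃ (f : X →L[ℂ] ℂ) (x : X), W = f.smulRight x}

theorem smulRight_mem_finiteRank (f : X →L[ℂ] ℂ) (x : X) : f.smulRight x ∈ finiteRank X :=
  Submodule.subset_span ⟨f, x, rfl⟩

theorem lie_mem_finiteRank {W : X →L[ℂ] X} (hW : W ∈ finiteRank X) (S : X →L[ℂ] X) :
    ⁅W, S⁆ ∈ finiteRank X := by
  induction hW using Submodule.span_induction with
  | mem W h =>
    obtain ⟨f, x, rfl⟩ := h
    rw [Ring.lie_def, smulRight_mul, mul_smulRight]
    exact Submodule.sub_mem _ (smulRight_mem_finiteRank _ _) (smulRight_mem_finiteRank _ _)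
  | zero => simp [Ring.lie_def]
  | add V W _ _ hV hW =>
    have : ⁅V + W, S⁆ = ⁅V, S⁆ + ⁅W, S⁆ := by simp only [Ring.lie_def]; noncomm_ring
    rw [this]
    exact Submodule.add_mem _ hV hW
  | smul c W _ hW =>
    have : ⁅c • W, S⁆ = c • ⁅W, S⁆ := by simp [Ring.lie_def, smul_sub]
    rw [this]
    exact Submodule.smul_mem _ c hW

theorem lie_mem_finiteRank' {W : X →L[ℂ] X} (hW : W ∈ finiteRank X) (S : X →L[ℂ] X) :
    ⁅S, W⁆ ∈ finiteRank X := by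
  have : ⁅S, W⁆ = -⁅W, S⁆ := by simp only [Ring.lie_def]; noncomm_ring
  rw [this]
  exact Submodule.neg_mem _ (lie_mem_finiteRank hW S)

theorem one_notMem_finiteRank (h : ¬ FiniteDimensional ℂ X) :
    (1 : X →L[ℂ] X) ∉ finiteRank X := by
  intro h1
  have key : ∀ W ∈ finiteRank X, FiniteDimensional ℂ (LinearMap.range (W : X →ₗ[ℂ] X)) := by
    intro W hW
    induction hW using Submodule.span_induction with
    | mem W h =>
      obtain ⟨f, x, rfl⟩ := h
      refine Submodule.finiteDimensional_of_le (S₂ := Submodule.span ℂ {x}) ?_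
      rintro _ ⟨v, rfl⟩
      exact Submodule.mem_span_singleton.2 ⟨f v, rfl⟩
    | zero =>
      refine Submodule.finiteDimensional_of_le (S₂ := ⊥) ?_
      rintro _ ⟨v, rfl⟩
      simp
    | add V W _ _ hV hW =>
      refine Submodule.finiteDimensional_of_le
        (S₂ := LinearMap.range (V : X →ₗ[ℂ] X) ⊔ LinearMap.range (W : X →ₗ[ℂ] X)) ?_
      rintro _ ⟨v, rfl⟩
      exact Submodule.add_mem_sup ⟨v, rfl⟩ ⟨v, rfl⟩
    | smul c W _ hW =>
      refine Submodule.finiteDimensional_of_le (S₂ := LinearMap.range (W : X →ₗ[ℂ] X)) ?_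
      rintro _ ⟨v, rfl⟩
      exact Submodule.smul_mem _ c ⟨v, rfl⟩
  have h2 := key 1 h1
  have h3 : LinearMap.range ((1 : X →L[ℂ] X) : X →ₗ[ℂ] X) = ⊤ :=
    LinearMap.range_eq_top.2 fun v => ⟨v, rfl⟩
  rw [h3] at h2
  exact h (Module.Finite.equiv (Submodule.topEquiv (R := ℂ) (M := X)))

/-- A linear functional that is normalized at the identity and vanishes on finite-rank operators. -/
theorem exists_functional_finiteRank (h : ¬ FiniteDimensional ℂ X) :
    ∃ ψ : (X →L[ℂ] X) →ₗ[ℂ] ℂ, ψ 1 = 1 ∧ ∀ W ∈ finiteRank X, ψ W = 0 := by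
  obtain ⟨ψ, h1, h2⟩ := Submodule.exists_le_ker_of_notMem (one_notMem_finiteRank h)
  refine ⟨(ψ 1)⁻¹ • ψ, by simp [h1], fun W hW => ?_⟩
  have : ψ W = 0 := h2 hW
  simp [this]

theorem exists_annihilator {M : Submodule ℂ X} (hM : IsClosed (M : Set X)) {y : X} (hy : y ∉ M) :
    ∃ f : X →L[ℂ] ℂ, (∀ x ∈ M, f x = 0) ∧ f y = 1 := by
  have : IsClosed (M : Set X) := hM
  obtain ⟨f, hf⟩ := exists_map_eq_one (x := M.mkQ y) (by simpa using hy)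
  refine ⟨f.comp M.mkQL, fun x hx => ?_, hf⟩
  have : M.mkQ x = 0 := by simpa using hx
  simpa using congrArg f this

end FiniteRank

/-! ### Rank-one operators and proper members of a nest. -/

section Nest

variable {X : Type*} [NormedAddCommGroup X] [NormedSpace ℂ X] {𝒩 : Set (Submodule ℂ X)}

theorem IsNest.smulRight_mem (h𝒩 : IsNest 𝒩) {M : Submodule ℂ X} (hM : M ∈ 𝒩)
    {f : X →L[ℂ] ℂ} (hf : ∀ y ∈ M, f y = 0) {x : X} (hx : x ∈ M) :
    f.smulRight x ∈ nestAlg 𝒩 := by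
  intro N hN v hv
  rcases h𝒩.total N hN M hM with h | h
  · simp [hf v (h hv)]
  · exact N.smul_mem _ (h hx)

/-- The linear span of the proper members of a family of subspaces. -/
def properSpan (𝒩 : Set (Submodule ℂ X)) : Submodule ℂ X := sSup {M ∈ 𝒩 | M ≠ ⊤}

theorem IsNest.mem_properSpan (h𝒩 : IsNest 𝒩) {N : Submodule ℂ X} (hN : N ∈ 𝒩) (hN' : N ≠ ⊤)
    {y : X} : y ∈ properSpan 𝒩 ↔ ∃ M ∈ 𝒩, M ≠ ⊤ ∧ y ∈ M := by
  have hne : {M ∈ 𝒩 | M ≠ ⊤}.Nonempty := ⟨N, hN, hN'⟩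
  rw [properSpan, Submodule.mem_sSup_of_directed hne]
  · simp only [Set.mem_ofPred_eq, and_assoc]
  · rintro A ⟨hA, hA'⟩ B ⟨hB, hB'⟩
    rcases h𝒩.total A hA B hB with h | h
    · exact ⟨B, ⟨hB, hB'⟩, h, le_rfl⟩
    · exact ⟨A, ⟨hA, hA'⟩, le_rfl, h⟩

/-- A largest proper member would be closed and contain the dense span of all proper members. -/
theorem IsNest.exists_gt (h𝒩 : IsNest 𝒩) (hd : (properSpan 𝒩).topologicalClosure = ⊤)
    {M : Submodule ℂ X} (hM : M ∈ 𝒩) (hM' : M ≠ ⊤) : ∃ M' ∈ 𝒩, M' ≠ ⊤ ∧ M < M' := by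
  by_contra! h
  refine hM' (top_le_iff.1 (hd ▸ Submodule.topologicalClosure_minimal _ ?_ (h𝒩.isClosed M hM)))
  refine sSup_le fun N hN => ?_
  rcases h𝒩.total N hN.1 M hM with h1 | h1
  · exact h1
  · by_contra h2
    exact h N hN.1 hN.2 (lt_of_le_not_ge h1 h2)

theorem IsNest.exists_ge (h𝒩 : IsNest 𝒩) {M : Submodule ℂ X} (hM : M ∈ 𝒩) (hM' : M ≠ ⊤) {y : X}
    (hy : y ∈ properSpan 𝒩) : ∃ M' ∈ 𝒩, M' ≠ ⊤ ∧ M ≤ M' ∧ y ∈ M' := by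
  obtain ⟨N, hN, hN', hyN⟩ := (h𝒩.mem_properSpan hM hM').1 hy
  rcases h𝒩.total M hM N hN with h | h
  · exact ⟨N, hN, hN', h, hyN⟩
  · exact ⟨M, hM, hM', le_rfl, h hyN⟩

theorem IsNest.not_finiteDimensional (h𝒩 : IsNest 𝒩)
    (hd : (properSpan 𝒩).topologicalClosure = ⊤) {N : Submodule ℂ X} (hN : N ∈ 𝒩) (hN' : N ≠ ⊤) :
    ¬ FiniteDimensional ℂ X := by
  intro hfin
  obtain ⟨M, ⟨hM, hM'⟩, hmax⟩ := (wellFounded_gt (α := Submodule ℂ X)).has_min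
    {M ∈ 𝒩 | M ≠ ⊤} ⟨N, hN, hN'⟩
  obtain ⟨M', h1, h2, h3⟩ := h𝒩.exists_gt hd hM hM'
  exact hmax M' ⟨h1, h2⟩ h3

theorem exists_mem_map_eq_one {U : Submodule ℂ X} (hd : U.topologicalClosure = ⊤) {f : X →L[ℂ] ℂ}
    (hf : f ≠ 0) : ∃ u ∈ U, f u = 1 := by
  obtain ⟨u, hu, hfu⟩ : ∃ u ∈ U, f u ≠ 0 := by
    by_contra! h
    refine hf (ContinuousLinearMap.ext_on (s := U) ?_ fun u hu => by simpa using h u hu)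
    rw [Submodule.span_eq]
    exact Submodule.dense_iff_topologicalClosure_eq_top.2 hd
  exact ⟨(f u)⁻¹ • u, U.smul_mem _ hu, by simp [hfu]⟩

end Nest

/-! ### Second case: the form of `L` on a proper member of the nest. -/

section NoGap

variable {X : Type*} [NormedAddCommGroup X] [NormedSpace ℂ X] {𝒩 : Set (Submodule ℂ X)}
  (h𝒩 : IsNest 𝒩) (hd : (properSpan 𝒩).topologicalClosure = ⊤)
  {L : nestAlg 𝒩 →ₗ[ℂ] (X →L[ℂ] X)} (hL : RespectsCommutatorRelations L)
  {ψ : (X →L[ℂ] X) →ₗ[ℂ] ℂ} (hψ1 : ψ 1 = 1) (hψ : ∀ W ∈ finiteRank X, ψ W = 0)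
  (hLψ : ∀ A, ψ (L A) = 0)

-- `ψ` turns the scalar supplied by the relation into zero once the left side has finite rank.
include hL hψ1 hψ in
theorem RespectsCommutatorRelations.eq_zero_of_mem_finiteRank (a₁ b₁ a₂ b₂ a₃ b₃ : nestAlg 𝒩)
    (h0 : ⁅a₁, b₁⁆ + ⁅a₂, b₂⁆ + ⁅a₃, b₃⁆ = 0)
    (hfr : (⁅L a₁, (b₁ : X →L[ℂ] X)⁆ + ⁅(a₁ : X →L[ℂ] X), L b₁⁆) +
      (⁅L a₂, (b₂ : X →L[ℂ] X)⁆ + ⁅(a₂ : X →L[ℂ] X), L b₂⁆) +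
      (⁅L a₃, (b₃ : X →L[ℂ] X)⁆ + ⁅(a₃ : X →L[ℂ] X), L b₃⁆) ∈ finiteRank X) :
    (⁅L a₁, (b₁ : X →L[ℂ] X)⁆ + ⁅(a₁ : X →L[ℂ] X), L b₁⁆) +
      (⁅L a₂, (b₂ : X →L[ℂ] X)⁆ + ⁅(a₂ : X →L[ℂ] X), L b₂⁆) +
      (⁅L a₃, (b₃ : X →L[ℂ] X)⁆ + ⁅(a₃ : X →L[ℂ] X), L b₃⁆) = 0 := by
  obtain ⟨s, hs⟩ := hL a₁ b₁ a₂ b₂ a₃ b₃ h0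
  have h1 := hψ _ hfr
  rw [hs, map_smul, hψ1, smul_eq_mul, mul_one] at h1
  rw [hs, h1, zero_smul]

include h𝒩 hd hL hψ1 hψ hLψ

/-- The image of a rank-one operator `v ↦ h v • x` has the form `v ↦ h v • w + r v • x`. -/
theorem map_smulRight_form {M : Submodule ℂ X} (hM : M ∈ 𝒩) (hM' : M ≠ ⊤) {h : X →L[ℂ] ℂ}
    (hh : h ≠ 0) {x : X} (hx : x ∈ M) (hx0 : x ≠ 0) {T : nestAlg 𝒩}
    (hT : (T : X →L[ℂ] X) = h.smulRight x) :
    ∃ (w : X) (r : X →L[ℂ] ℂ), L T = h.smulRight w + r.smulRight x := by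
  set U := properSpan 𝒩 with hU
  obtain ⟨u₀, hu₀, hhu₀⟩ := exists_mem_map_eq_one hd hh
  have hT' : ∀ v, (T : X →L[ℂ] X) v = h v • x := fun v => by rw [hT]; rfl
  have step : ∀ y ∈ U, h y = 0 → ∃ c : ℂ, L T y - c • y ∈ Submodule.span ℂ {x} := by
    intro y hy hhy
    obtain ⟨M₁, hM₁, hM₁', hMM₁, hyM₁⟩ := h𝒩.exists_ge hM hM' hy
    -- `M₂` contains x, y and u₀: then `g` kills x, so [T, S] = 0, and correcting z₀ by a multiple
    -- of u₀ keeps g z = 1.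
    obtain ⟨M₂, hM₂, hM₂', hMM₂, hyM₂⟩ := h𝒩.exists_ge hM₁ hM₁' hu₀
    obtain ⟨z₀, hz₀⟩ : ∃ z, z ∉ M₂ := by
      by_contra! h
      exact hM₂' (Submodule.eq_top_iff'.2 h)
    obtain ⟨g, hg, hgz₀⟩ := exists_annihilator (h𝒩.isClosed M₂ hM₂) hz₀
    let S : nestAlg 𝒩 := ⟨g.smulRight y, h𝒩.smulRight_mem hM₂ hg (hMM₂ hyM₁)⟩
    have hS : (S : X →L[ℂ] X) = g.smulRight y := rfl
    have hS' : ∀ v, (S : X →L[ℂ] X) v = g v • y := fun v => rfl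
    have hgx : g x = 0 := hg x (hMM₂ (hMM₁ hx))
    have hTS : ⁅T, S⁆ = 0 := by
      refine subalgebra_ext fun v => ?_
      rw [coe_lie, lie_apply]
      simp [hT', hS', hhy, hgx]
    have hz : ⁅(0 : nestAlg 𝒩), (0 : nestAlg 𝒩)⁆ = 0 := by simp [Ring.lie_def]
    have hz' : ⁅L 0, ((0 : nestAlg 𝒩) : X →L[ℂ] X)⁆ +
        ⁅((0 : nestAlg 𝒩) : X →L[ℂ] X), L 0⁆ = 0 := by simp [Ring.lie_def]
    have h1 := hL.eq_zero_of_mem_finiteRank hψ1 hψ T S 0 0 0 0 (by rw [hTS, hz]; simp) (by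
      rw [hz', add_zero, add_zero, hT, hS]
      exact Submodule.add_mem _ (lie_mem_finiteRank' (smulRight_mem_finiteRank _ _) _)
        (lie_mem_finiteRank (smulRight_mem_finiteRank _ _) _))
    rw [hz', add_zero, add_zero] at h1
    have hgu₀ : g u₀ = 0 := hg u₀ hyM₂
    set z := z₀ - h z₀ • u₀ with hz
    have hhz : h z = 0 := by simp [hz, hhu₀]
    have hgz : g z = 1 := by simp [hz, hgu₀, hgz₀]
    have h2 := congrArg (fun W : X →L[ℂ] X => W z) h1
    simp only [add_apply, zero_apply, lie_apply, hT', hS', hhz, hgz, zero_smul, one_smul,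
      map_zero] at h2
    refine ⟨g (L T z), Submodule.mem_span_singleton.2 ⟨-h (L S z), ?_⟩⟩
    linear_combination (norm := module) -h2
  -- Modulo x, every y in U ∩ ker h is an eigenvector of `L T`, so a single scalar c serves them
  -- all.
  obtain ⟨c, hc⟩ := exists_eq_smul_of_forall (V := ↥(U ⊓ LinearMap.ker (h : X →ₗ[ℂ] ℂ)))
    (F := (Submodule.span ℂ {x}).mkQ ∘ₗ (L T : X →ₗ[ℂ] X) ∘ₗ Submodule.subtype _)
    (G := (Submodule.span ℂ {x}).mkQ ∘ₗ Submodule.subtype _) (by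
      rintro ⟨y, hy⟩
      obtain ⟨c, hc⟩ := step y hy.1 hy.2
      refine ⟨c, ?_⟩
      rw [← sub_eq_zero]
      simpa using (Submodule.Quotient.mk_eq_zero _).2 hc)
  obtain ⟨φ, hφ⟩ := exists_map_eq_one hx0
  set P : X →L[ℂ] X := (L T - c • 1) * (1 - h.smulRight u₀) with hP
  have hPv : ∀ v, P v = L T v - h v • L T u₀ - c • (v - h v • u₀) := fun v => by
    simp [hP]
  have hPx : P = (φ.comp P).smulRight x := by
    refine ContinuousLinearMap.ext_on (s := U) ?_ fun v hv => ?_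
    · rw [Submodule.span_eq]
      exact Submodule.dense_iff_topologicalClosure_eq_top.2 hd
    have h1 := hc ⟨v - h v • u₀, U.sub_mem hv (U.smul_mem _ hu₀), by simp [hhu₀]⟩
    rw [← sub_eq_zero] at h1
    have h2 : P v ∈ Submodule.span ℂ {x} := by
      rw [← Submodule.Quotient.mk_eq_zero, ← h1, hPv]
      simp
    obtain ⟨t, ht⟩ := Submodule.mem_span_singleton.1 h2
    simp [← ht, hφ]
  have hform : L T = c • (1 : X →L[ℂ] X) +
      (h.smulRight (L T u₀ - c • u₀) + (φ.comp P).smulRight x) := by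
    rw [← hPx]
    ext v
    simp only [add_apply, smul_apply, one_apply_eq_self, ContinuousLinearMap.smulRight_apply, hPv]
    module
  have hc0 : c = 0 := by
    have h1 := hLψ T
    rw [hform, map_add, map_smul, hψ1, hψ _ (Submodule.add_mem _ (smulRight_mem_finiteRank _ _)
      (smulRight_mem_finiteRank _ _))] at h1
    simpa using h1
  refine ⟨L T u₀ - c • u₀, φ.comp P, ?_⟩
  conv_lhs => rw [hform, hc0, zero_smul, zero_add]
  rw [hc0]

omit h𝒩 hd hL hψ1 hψ hLψ in
/-- `L` maps `v ↦ h v • x`, for `x ∈ M`, to `v ↦ h v • σ x + r v • x`. -/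
def HasForm (L : nestAlg 𝒩 →ₗ[ℂ] (X →L[ℂ] X)) (M : Submodule ℂ X) (h : X →L[ℂ] ℂ)
    (σ : X →ₗ[ℂ] X) (r : X →L[ℂ] ℂ) : Prop :=
  ∀ x ∈ M, ∀ T : nestAlg 𝒩, (T : X →L[ℂ] X) = h.smulRight x →
    L T = h.smulRight (σ x) + r.smulRight x

/-- For v in ker h, x ↦ L(h⊗x)v sends each x in M to a multiple of x, so the factor r v does not
depend on x. Then σ is read off at a point where h = 1; its values off M play no role. -/
theorem exists_hasForm {M : Submodule ℂ X} (hM : M ∈ 𝒩) (hM' : M ≠ ⊤) {x₀ : X}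
    (hx₀M : x₀ ∈ M) (hx₀ : x₀ ≠ 0) {h : X →L[ℂ] ℂ} (hh : h ≠ 0) (hhM : ∀ y ∈ M, h y = 0) :
    ∃ σ r, HasForm L M h σ r := by
  obtain ⟨z, hz⟩ := exists_eq_one_of_ne_zero hh
  obtain ⟨φ, hφ⟩ := exists_map_eq_one hx₀
  let R : M →ₗ[ℂ] nestAlg 𝒩 :=
    { toFun := fun x => ⟨h.smulRight (x : X), h𝒩.smulRight_mem hM hhM x.2⟩
      map_add' := fun x y => subalgebra_ext fun v => by simp
      map_smul' := fun c x => subalgebra_ext fun v => by simp [smul_smul, mul_comm] }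
  have hR : ∀ x, (R x : X →L[ℂ] X) = h.smulRight (x : X) := fun _ => rfl
  let ev : X → (X →L[ℂ] X) →ₗ[ℂ] X := fun v =>
    { toFun := fun W => W v
      map_add' := fun _ _ => rfl
      map_smul' := fun _ _ => rfl }
  obtain ⟨σ, hσ⟩ := LinearMap.exists_extend (ev z ∘ₗ L ∘ₗ R)
  have hσ' : ∀ x : M, σ x = L (R x) z := fun x => congrArg (fun f => f x) hσ
  let r : X →L[ℂ] ℂ := φ.comp (L (R ⟨x₀, hx₀M⟩) * (1 - h.smulRight z))
  have hr : ∀ v, r v = φ (L (R ⟨x₀, hx₀M⟩) (v - h v • z)) := fun v => by simp [r]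
  refine ⟨σ, r, fun x hx T hT => ?_⟩
  have hTR : T = R ⟨x, hx⟩ := Subtype.ext hT
  have key : ∀ v, h v = 0 → L T v = φ (L (R ⟨x₀, hx₀M⟩) v) • x := by
    intro v hv
    obtain ⟨c, hc⟩ := exists_eq_smul_of_forall (F := ev v ∘ₗ L ∘ₗ R) (G := M.subtype) (by
      rintro ⟨y, hy⟩
      rcases eq_or_ne y 0 with rfl | hy0
      · refine ⟨0, ?_⟩
        rw [show (⟨0, hy⟩ : M) = 0 from rfl, map_zero, map_zero, smul_zero]
      · obtain ⟨w, s, hws⟩ := map_smulRight_form h𝒩 hd hL hψ1 hψ hLψ hM hM' hh hy hy0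
          (hR ⟨y, hy⟩)
        exact ⟨s v, by simp [ev, hws, hv]⟩)
    have h1 : L (R ⟨x, hx⟩) v = c • x := hc ⟨x, hx⟩
    have h2 : L (R ⟨x₀, hx₀M⟩) v = c • x₀ := hc ⟨x₀, hx₀M⟩
    rw [hTR, h1, h2, map_smul, hφ, smul_eq_mul, mul_one]
  ext v
  have h1 := key (v - h v • z) (by simp [hz])
  rw [← hr, map_sub, map_smul] at h1
  have h2 := hσ' ⟨x, hx⟩
  rw [← hTR] at h2
  simp only [add_apply, ContinuousLinearMap.smulRight_apply]
  rw [h2]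
  linear_combination (norm := module) h1

/-- One σ serves all functionals. Comparing f, g and f + g shows that the map found for g differs
from σ on M by a scalar, which `s` absorbs. -/
theorem HasForm.exists_of_le {M M' : Submodule ℂ X} (hM : M ∈ 𝒩) (hM' : M' ∈ 𝒩) (hMt : M ≠ ⊤)
    (hMM' : M ≤ M') {x₀ : X} (hx₀M : x₀ ∈ M) (hx₀ : x₀ ≠ 0) {f g : X →L[ℂ] ℂ} (hf0 : f ≠ 0)
    (hf : ∀ y ∈ M', f y = 0) (hg : ∀ y ∈ M, g y = 0) {σ : X →ₗ[ℂ] X} {r : X →L[ℂ] ℂ}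
    (hform : HasForm L M' f σ r) : ∃ s, HasForm L M g σ s := by
  by_cases hgf : ∃ t : ℂ, g = t • f
  · obtain ⟨t, rfl⟩ := hgf
    refine ⟨t • r, fun x hx T hT => ?_⟩
    let T₀ : nestAlg 𝒩 := ⟨f.smulRight x, h𝒩.smulRight_mem hM' hf (hMM' hx)⟩
    have h1 : T = t • T₀ := subalgebra_ext fun v => by rw [hT]; simp [T₀, smul_smul]
    rw [h1, map_smul, hform x (hMM' hx) T₀ rfl]
    ext v
    simp [smul_smul]
  · have hg0 : g ≠ 0 := by
      rintro rfl
      exact hgf ⟨0, ContinuousLinearMap.ext fun v => by simp⟩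
    have hfg0 : f + g ≠ 0 := by
      intro h
      refine hgf ⟨-1, ContinuousLinearMap.ext fun v => ?_⟩
      have h1 : f v + g v = 0 := congrArg (fun F : X →L[ℂ] ℂ => F v) h
      rw [smul_apply, smul_eq_mul]
      linear_combination h1
    obtain ⟨z, hz⟩ := exists_eq_one_of_ne_zero hf0
    obtain ⟨v, hfv, hgv⟩ : ∃ v, f v = 0 ∧ g v = 1 := by
      have : ∃ v, f v = 0 ∧ g v ≠ 0 := by
        by_contra! h
        refine hgf ⟨g z, ContinuousLinearMap.ext fun v => ?_⟩
        have h1 := h (v - f v • z) (by simp [hz])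
        rw [map_sub, map_smul, sub_eq_zero] at h1
        rw [h1]; simp [mul_comm]
      obtain ⟨v, h1, h2⟩ := this
      exact ⟨(g v)⁻¹ • v, by simp [h1], by simp [h2]⟩
    set v' := z - g z • v with hv'
    have hfv' : f v' = 1 := by simp [hv', hz, hfv]
    have hgv' : g v' = 0 := by simp [hv', hgv]
    have hfgM : ∀ y ∈ M, (f + g) y = 0 := fun y hy => by simp [hf y (hMM' hy), hg y hy]
    obtain ⟨σ₁, r₁, h₁⟩ := exists_hasForm h𝒩 hd hL hψ1 hψ hLψ hM hMt hx₀M hx₀ hg0 hg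
    obtain ⟨σ₂, r₂, h₂⟩ := exists_hasForm h𝒩 hd hL hψ1 hψ hLψ hM hMt hx₀M hx₀ hfg0 hfgM
    refine ⟨r₁ + (r₂ v - r₁ v - r v - (r₂ v' - r₁ v' - r v')) • g, fun x hx T hT => ?_⟩
    let T₀ : nestAlg 𝒩 := ⟨f.smulRight x, h𝒩.smulRight_mem hM' hf (hMM' hx)⟩
    have e₂ := h₂ x hx (T₀ + T) (by
      rw [Subalgebra.coe_add, hT]
      ext v
      simp [T₀, add_smul])
    rw [map_add, hform x (hMM' hx) T₀ rfl, h₁ x hx T hT] at e₂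
    have ev := congrArg (fun W : X →L[ℂ] X => W v) e₂
    have ev' := congrArg (fun W : X →L[ℂ] X => W v') e₂
    simp only [add_apply, ContinuousLinearMap.smulRight_apply, hfv, hgv, hfv', hgv'] at ev ev'
    rw [h₁ x hx T hT]
    ext u
    simp only [add_apply, smul_apply, ContinuousLinearMap.smulRight_apply, smul_eq_mul]
    linear_combination (norm := module) g u • (ev - ev')

/-- On a proper member of the nest, `L` is a derivation up to the centroid and scalars. -/
theorem exists_local_form {M : Submodule ℂ X} (hM : M ∈ 𝒩) (hM0 : M ≠ ⊥) (hMt : M ≠ ⊤) :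
    ∃ (σ : X →ₗ[ℂ] X) (k : ℂ) (χ : nestAlg 𝒩 →ₗ[ℂ] ℂ), ∀ (A : nestAlg 𝒩), ∀ x ∈ M,
      L A x = σ ((A : X →L[ℂ] X) x) - (A : X →L[ℂ] X) (σ x) + k • (A : X →L[ℂ] X) x + χ A • x := by
  obtain ⟨x₀, hx₀M, hx₀⟩ := Submodule.exists_mem_ne_zero_of_ne_bot hM0
  obtain ⟨M', hM', hM't, hMM'⟩ := h𝒩.exists_gt hd hM hMt
  obtain ⟨y, hyM', hyM⟩ := Set.exists_of_ssubset hMM'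
  obtain ⟨g, hgM, hgy⟩ := exists_annihilator (h𝒩.isClosed M hM) hyM
  obtain ⟨z₀, hz₀⟩ : ∃ z, z ∉ M' := by
    by_contra! h
    exact hM't (Submodule.eq_top_iff'.2 h)
  obtain ⟨f, hfM', hfz₀⟩ := exists_annihilator (h𝒩.isClosed M' hM') hz₀
  have hf0 : f ≠ 0 := by rintro rfl; simp at hfz₀
  set z := z₀ - g z₀ • y with hz
  have hfz : f z = 1 := by simp [hz, hfz₀, hfM' y hyM']
  have hgz : g z = 0 := by simp [hz, hgy]
  obtain ⟨σ, r, hform⟩ := exists_hasForm h𝒩 hd hL hψ1 hψ hLψ hM' hM't (hMM'.le hx₀M) hx₀ hf0 hfM'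
  obtain ⟨rg, hformg⟩ := hform.exists_of_le h𝒩 hd hL hψ1 hψ hLψ hM hM' hMt hMM'.le hx₀M hx₀ hf0
    hfM' hgM
  have hfA : ∀ A : nestAlg 𝒩, ∀ y ∈ M', f.comp (A : X →L[ℂ] X) y = 0 := fun A y hy =>
    hfM' _ (A.2 M' hM' y hy)
  have hex : ∀ A : nestAlg 𝒩, ∃ s, HasForm L M' (f.comp (A : X →L[ℂ] X)) σ s := fun A =>
    hform.exists_of_le h𝒩 hd hL hψ1 hψ hLψ hM' hM' hM't le_rfl (hMM'.le hx₀M) hx₀ hf0 hfM' (hfA A)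
  set k := rg y + g (σ y) with hk
  have key : ∀ A : nestAlg 𝒩, ∃ t : ℂ, ∀ x ∈ M,
      L A x = σ ((A : X →L[ℂ] X) x) - (A : X →L[ℂ] X) (σ x) + k • (A : X →L[ℂ] X) x + t • x := by
    intro A
    obtain ⟨s, hs⟩ := hex A
    refine ⟨f (L A z) + r ((A : X →L[ℂ] X) z) - f ((A : X →L[ℂ] X) z) * k - s z, fun x hx => ?_⟩
    have hAx : (A : X →L[ℂ] X) x ∈ M := A.2 M hM x hx
    have hx' := hMM'.le hx
    have hAx' := hMM'.le hAx
    let T : nestAlg 𝒩 := ⟨f.smulRight x, h𝒩.smulRight_mem hM' hfM' hx'⟩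
    let a₂ : nestAlg 𝒩 := ⟨g.smulRight ((A : X →L[ℂ] X) x), h𝒩.smulRight_mem hM hgM hAx⟩
    let b₂ : nestAlg 𝒩 := ⟨f.smulRight y, h𝒩.smulRight_mem hM' hfM' hyM'⟩
    let a₃ : nestAlg 𝒩 := ⟨g.smulRight x, h𝒩.smulRight_mem hM hgM hx⟩
    let b₃ : nestAlg 𝒩 := ⟨(f.comp (A : X →L[ℂ] X)).smulRight y,
      h𝒩.smulRight_mem hM' (hfA A) hyM'⟩
    have cT : (T : X →L[ℂ] X) = f.smulRight x := rfl
    have ca₂ : ((-a₂ : nestAlg 𝒩) : X →L[ℂ] X) = -g.smulRight ((A : X →L[ℂ] X) x) := rfl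
    have cb₂ : (b₂ : X →L[ℂ] X) = f.smulRight y := rfl
    have ca₃ : (a₃ : X →L[ℂ] X) = g.smulRight x := rfl
    have cb₃ : (b₃ : X →L[ℂ] X) = (f.comp (A : X →L[ℂ] X)).smulRight y := rfl
    have eT := hform x hx' T rfl
    have ea₂ : L (-a₂) = -(g.smulRight (σ ((A : X →L[ℂ] X) x)) +
        rg.smulRight ((A : X →L[ℂ] X) x)) := by
      rw [map_neg, hformg _ hAx a₂ rfl]
    have eb₂ := hform y hyM' b₂ rfl
    have ea₃ := hformg x hx a₃ rfl
    have eb₃ := hs y hyM' b₃ rfl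
    have hfx := hfM' x hx'
    have hfAx := hfM' _ hAx'
    -- As g y = 1 and f kills x and Ax, [A, f⊗x] = [g⊗Ax, f⊗y] − [g⊗x, (f∘A)⊗y], whose right side
    -- has known derivatives. At z, where f = 1 and g = 0, the left side yields L A x.
    have hrel : ⁅A, T⁆ + ⁅-a₂, b₂⁆ + ⁅a₃, b₃⁆ = 0 := by
      refine subalgebra_ext fun v => ?_
      rw [Subalgebra.coe_add, Subalgebra.coe_add, coe_lie, coe_lie, coe_lie, add_apply, add_apply,
        lie_apply, lie_apply, lie_apply, cT, ca₂, cb₂, ca₃, cb₃]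
      simp [hfAx, hgy]
      abel
    have h1 := hL.eq_zero_of_mem_finiteRank hψ1 hψ A T (-a₂) b₂ a₃ b₃ hrel (by
      rw [eT, cb₂, ca₂, ca₃, cb₃, cT]
      have m := fun (f : X →L[ℂ] ℂ) (x : X) => smulRight_mem_finiteRank f x
      refine Submodule.add_mem _ (Submodule.add_mem _ (Submodule.add_mem _ ?_ ?_)
        (Submodule.add_mem _ ?_ ?_)) (Submodule.add_mem _ ?_ ?_)
      · exact lie_mem_finiteRank' (m _ _) _
      · exact lie_mem_finiteRank' (Submodule.add_mem _ (m _ _) (m _ _)) _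
      · exact lie_mem_finiteRank' (m _ _) _
      · exact lie_mem_finiteRank (Submodule.neg_mem _ (m _ _)) _
      · exact lie_mem_finiteRank' (m _ _) _
      · exact lie_mem_finiteRank (m _ _) _)
    have h2 := congrArg (fun W : X →L[ℂ] X => W z) h1
    simp only [add_apply, zero_apply, lie_apply, cT, ca₂, cb₂, ca₃, cb₃, eT, ea₂, eb₂, ea₃, eb₃,
      neg_apply, ContinuousLinearMap.smulRight_apply, ContinuousLinearMap.comp_apply, map_add,
      map_neg, map_smul, map_zero, hfAx, hfz, hgz, hgy, zero_smul, one_smul, smul_zero, zero_add,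
      neg_zero, sub_zero] at h2
    linear_combination (norm := module) h2
  choose t ht using key
  obtain ⟨φ, hφ⟩ := exists_map_eq_one hx₀
  have htφ : ∀ A, t A = φ (L A x₀ - (σ ((A : X →L[ℂ] X) x₀) - (A : X →L[ℂ] X) (σ x₀) +
      k • (A : X →L[ℂ] X) x₀)) := fun A => by
    rw [ht A x₀ hx₀M, add_sub_cancel_left, map_smul, hφ, smul_eq_mul, mul_one]
  refine ⟨σ, k, ⟨⟨t, fun A B => ?_⟩, fun c A => ?_⟩, ht⟩
  · show t (A + B) = t A + t B
    rw [htφ, htφ, htφ, ← map_add]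
    congr 1
    simp only [map_add, add_apply, Subalgebra.coe_add]
    module
  · show t (c • A) = c • t A
    rw [htφ, htφ]
    refine Eq.trans ?_ (map_smul φ c _)
    congr 1
    have hc : ∀ v, ((c • A : nestAlg 𝒩) : X →L[ℂ] X) v = c • (A : X →L[ℂ] X) v := fun _ => rfl
    simp only [map_smul, smul_apply, hc]
    module

end NoGap

/-! ### Uniqueness of the local data and passage to all of X. -/

section Globalization

variable {X : Type*} [NormedAddCommGroup X] [NormedSpace ℂ X] {𝒩 : Set (Submodule ℂ X)}
  (h𝒩 : IsNest 𝒩) {L : nestAlg 𝒩 →ₗ[ℂ] (X →L[ℂ] X)}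

theorem exists_annihilator_ne {M M' : Submodule ℂ X} (hM : IsClosed (M : Set X)) (h : M < M') :
    ∃ f : X →L[ℂ] ℂ, (∀ x ∈ M, f x = 0) ∧ ∃ y ∈ M', y ∉ M ∧ f y = 1 := by
  obtain ⟨y, hyM', hyM⟩ := Set.exists_of_ssubset h
  obtain ⟨f, hf, hfy⟩ := exists_annihilator hM hyM
  exact ⟨f, hf, y, hyM', hyM, hfy⟩

include h𝒩 in
/-- On a member of the nest with at least two predecessors, the central and scalar parts of `L` are
unique. -/
theorem local_form_unique {M₁ M₂ M : Submodule ℂ X} (hM₁ : M₁ ∈ 𝒩) (hM₂ : M₂ ∈ 𝒩) (h0 : M₁ ≠ ⊥)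
    (h12 : M₁ < M₂) (h2 : M₂ < M) (hM : M ∈ 𝒩) {σ σ' : X →ₗ[ℂ] X} {k k' : ℂ}
    {χ χ' : nestAlg 𝒩 →ₗ[ℂ] ℂ}
    (h : ∀ (A : nestAlg 𝒩), ∀ x ∈ M, L A x =
      σ ((A : X →L[ℂ] X) x) - (A : X →L[ℂ] X) (σ x) + k • (A : X →L[ℂ] X) x + χ A • x)
    (h' : ∀ (A : nestAlg 𝒩), ∀ x ∈ M, L A x =
      σ' ((A : X →L[ℂ] X) x) - (A : X →L[ℂ] X) (σ' x) + k' • (A : X →L[ℂ] X) x + χ' A • x) :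
    k' = k ∧ χ' = χ := by
  obtain ⟨x₁, hx₁, hx₁0⟩ := Submodule.exists_mem_ne_zero_of_ne_bot h0
  obtain ⟨f, hf, y, hy, hyM₁, hfy⟩ := exists_annihilator_ne (h𝒩.isClosed M₁ hM₁) h12
  obtain ⟨g, hg, u, hu, -, hgu⟩ := exists_annihilator_ne (h𝒩.isClosed M₂ hM₂) h2
  have hy0 : y ≠ 0 := fun h => hyM₁ (h ▸ M₁.zero_mem)
  have hgy : g y = 0 := hg y hy
  have hfx₁ : f x₁ = 0 := hf x₁ hx₁
  have hyM : y ∈ M := h2.le hy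
  have hx₁M : x₁ ∈ M := h2.le (h12.le hx₁)
  set κ := k' - k with hκ
  set ξ := χ' - χ with hξ
  -- On M, C ↦ κC + ξ(C) is implemented by σ' − σ up to sign, hence is a derivation; its product
  -- rule reads as follows.
  have key : ∀ A B : nestAlg 𝒩, ∀ x ∈ M, κ • (A : X →L[ℂ] X) ((B : X →L[ℂ] X) x) +
      ξ A • (B : X →L[ℂ] X) x + ξ B • (A : X →L[ℂ] X) x - ξ (A * B) • x = 0 := by
    intro A B x hx
    have hBx : (B : X →L[ℂ] X) x ∈ M := B.2 M hM x hx
    have e₁ : ∀ (C : nestAlg 𝒩), ∀ x ∈ M, (σ' - σ) ((C : X →L[ℂ] X) x) -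
        (C : X →L[ℂ] X) ((σ' - σ) x) + κ • (C : X →L[ℂ] X) x + ξ C • x = 0 := by
      intro C x hx
      have := (h C x hx).symm.trans (h' C x hx)
      simp only [LinearMap.sub_apply, map_sub, hκ, hξ]
      linear_combination (norm := module) -this
    have eAB := e₁ (A * B) x hx
    have eA := e₁ A _ hBx
    have eB := congrArg (A : X →L[ℂ] X) (e₁ B x hx)
    simp only [map_add, map_sub, map_smul, map_zero] at eB
    simp only [Subalgebra.coe_mul, mul_apply_eq_comp] at eAB
    linear_combination (norm := skip) eA + eB - eAB
    simp only [LinearMap.sub_apply, map_sub]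
    module
  -- Both `T` and `S` have square zero, which forces ξ to vanish on them, while T S u = x₁ ≠ 0
  -- exposes κ.
  let T : nestAlg 𝒩 := ⟨f.smulRight x₁, h𝒩.smulRight_mem hM₁ hf hx₁⟩
  let S : nestAlg 𝒩 := ⟨g.smulRight y, h𝒩.smulRight_mem hM₂ hg hy⟩
  have hT : ∀ v, (T : X →L[ℂ] X) v = f v • x₁ := fun _ => rfl
  have hS : ∀ v, (S : X →L[ℂ] X) v = g v • y := fun _ => rfl
  have hTT : T * T = 0 := subalgebra_ext fun v => by simp [hT, hfx₁]
  have hSS : S * S = 0 := subalgebra_ext fun v => by simp [hS, hgy]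
  have hξT : ξ T = 0 := by
    have := key T T y hyM
    rw [hTT, map_zero, zero_smul, hT, hT, hfy, one_smul, hfx₁, zero_smul, smul_zero, zero_add,
      sub_zero, ← add_smul, smul_eq_zero, or_iff_left hx₁0] at this
    simpa using this
  have hξS : ξ S = 0 := by
    have := key S S u hu
    rw [hSS, map_zero, zero_smul, hS, hS, hgu, one_smul, hgy, zero_smul, smul_zero, zero_add,
      sub_zero, ← add_smul, smul_eq_zero, or_iff_left hy0] at this
    simpa using this
  have hξTS : ξ (T * S) = 0 := by
    have := key T S y hyM
    rw [hξT, hξS, hS, hgy, zero_smul, map_zero] at this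
    simpa [hy0] using this
  have hκ0 : κ = 0 := by
    have := key T S u hu
    rw [hξT, hξS, hξTS, hS, hgu, one_smul, hT, hfy, one_smul] at this
    simpa [hx₁0] using this
  have hξ0 : ∀ A, ξ A = 0 := by
    intro A
    have h3 := key A T x₁ hx₁M
    rw [hκ0, hξT, hT, hfx₁] at h3
    have h4 : ξ (A * T) = 0 := by simpa [hx₁0] using h3
    have h5 := key A T y hyM
    rw [hκ0, hξT, h4, hT, hfy] at h5
    simpa [hx₁0] using h5
  exact ⟨sub_eq_zero.1 hκ0, sub_eq_zero.1 (LinearMap.ext hξ0)⟩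

include h𝒩 in
theorem isDerivationModCentroid_of_properSpan_dense
    (hd : (properSpan 𝒩).topologicalClosure = ⊤) {N : Submodule ℂ X} (hN : N ∈ 𝒩) (hN0 : N ≠ ⊥)
    (hNt : N ≠ ⊤) (hL : RespectsCommutatorRelations L) : IsDerivationModCentroid L := by
  obtain ⟨ψ, hψ1, hψ⟩ := exists_functional_finiteRank (h𝒩.not_finiteDimensional hd hN hNt)
  set L' := L - (ψ ∘ₗ L).smulRight (1 : X →L[ℂ] X) with hL'
  have hψL' : ∀ A, ψ (L' A) = 0 := fun A => by simp [hL', hψ1]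
  have loc := fun (M : Submodule ℂ X) => exists_local_form (M := M) h𝒩 hd (hL.sub_scalar (ψ ∘ₗ L))
    hψ1 hψ hψL'
  obtain ⟨M₂, hM₂, hM₂t, hlt⟩ := h𝒩.exists_gt hd hN hNt
  obtain ⟨M, hM, hMt, hltM⟩ := h𝒩.exists_gt hd hM₂ hM₂t
  obtain ⟨σ, k, χ, hσ⟩ := loc M hM (bot_lt_of_lt hltM).ne' hMt
  set D := L' - k • (nestAlg 𝒩).val.toLinearMap - χ.smulRight (1 : X →L[ℂ] X) with hD
  refine ⟨D, k, χ + ψ ∘ₗ L, fun A B => ?_, ?_⟩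
  · refine ContinuousLinearMap.ext_on (s := properSpan 𝒩) ?_ fun y hy => ?_
    · rw [Submodule.span_eq]
      exact Submodule.dense_iff_topologicalClosure_eq_top.2 hd
    -- The form on the larger M' restricts to M, so uniqueness there identifies its k and χ with
    -- those that define `D`.
    obtain ⟨M', hM', hM't, hMM', hyM'⟩ := h𝒩.exists_ge hM hMt hy
    obtain ⟨σ', k', χ', hσ'⟩ := loc M' hM' (bot_lt_of_lt (hltM.trans_le hMM')).ne' hM't
    obtain ⟨rfl, rfl⟩ := local_form_unique h𝒩 hN hM₂ hN0 hlt hltM hM hσ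
      fun A x hx => hσ' A x (hMM' hx)
    have hDy : ∀ (C : nestAlg 𝒩), ∀ x ∈ M', D C x = σ' ((C : X →L[ℂ] X) x) -
        (C : X →L[ℂ] X) (σ' x) := by
      intro C x hx
      have := hσ' C x hx
      simp only [hD, LinearMap.sub_apply, LinearMap.smul_apply, LinearMap.smulRight_apply,
        sub_apply, smul_apply, one_apply_eq_self, AlgHom.toLinearMap_apply, Subalgebra.coe_val]
      rw [this]
      abel
    simp only [add_apply, mul_apply_eq_comp]
    rw [hDy _ y hyM', hDy A _ (B.2 M' hM' y hyM'), hDy B y hyM']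
    simp only [Subalgebra.coe_mul, mul_apply_eq_comp, map_sub]
    abel
  · have : (χ + ψ ∘ₗ L).smulRight (1 : X →L[ℂ] X) =
        χ.smulRight (1 : X →L[ℂ] X) + (ψ ∘ₗ L).smulRight (1 : X →L[ℂ] X) := by
      ext A : 1
      simp [add_smul]
    rw [this, hD, hL']
    abel

end Globalization

/-! ### The dichotomy and the assembly of the theorem. -/

section Main

variable {X : Type*} [NormedAddCommGroup X] [NormedSpace ℂ X] {𝒩 : Set (Submodule ℂ X)}

theorem IsNest.exists_nontrivial (h𝒩 : IsNest 𝒩) (h : 𝒩 ≠ {⊥, ⊤}) :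
    ∃ N ∈ 𝒩, N ≠ ⊥ ∧ N ≠ ⊤ := by
  by_contra! h1
  refine h (Set.eq_of_subset_of_subset (fun N hN => ?_) ?_)
  · by_cases h2 : N = ⊥
    · exact Or.inl h2
    · exact Or.inr (h1 N hN h2)
  · rintro N (rfl | rfl)
    · exact h𝒩.bot_mem
    · exact h𝒩.top_mem

theorem isClosed_nestAlg (h𝒩 : IsNest 𝒩) : IsClosed (nestAlg 𝒩 : Set (X →L[ℂ] X)) := by
  have : (nestAlg 𝒩 : Set (X →L[ℂ] X)) = ⋂ N ∈ 𝒩, ⋂ x ∈ N, {T : X →L[ℂ] X | T x ∈ N} := by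
    ext T
    simp only [Set.mem_iInter]
    rfl
  rw [this]
  refine isClosed_biInter fun N hN => isClosed_biInter fun x _ => ?_
  exact (h𝒩.isClosed N hN).preimage (ContinuousLinearMap.apply ℂ X x).continuous

variable (𝒩) in
/-- Either the proper members of the family span a dense subspace, or all operators
`v ↦ f v • u` with some fixed `f ≠ 0` belong to the nest algebra. -/
theorem dense_or_exists :
    (properSpan 𝒩).topologicalClosure = ⊤ ∨
      ∃ f : X →L[ℂ] ℂ, f ≠ 0 ∧ ∀ u, f.smulRight u ∈ nestAlg 𝒩 := by
  refine or_iff_not_imp_left.2 fun h => ?_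
  set K := (properSpan 𝒩).topologicalClosure with hK
  obtain ⟨z, hz⟩ : ∃ z, z ∉ K := by
    by_contra! h1
    exact h (Submodule.eq_top_iff'.2 h1)
  obtain ⟨f, hf, hfz⟩ := exists_annihilator (Submodule.isClosed_topologicalClosure _) hz
  refine ⟨f, by rintro rfl; simp at hfz, fun u N hN v hv => ?_⟩
  by_cases hNt : N = ⊤
  · rw [hNt]; trivial
  · have hNK : N ≤ K := le_trans (le_sSup (show N ∈ {M ∈ 𝒩 | M ≠ ⊤} from ⟨hN, hNt⟩))
      (Submodule.le_topologicalClosure _)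
    simp [hf v (hNK hv)]

theorem IsNest.exists_sq_zero (h𝒩 : IsNest 𝒩) {N : Submodule ℂ X} (hN : N ∈ 𝒩) (hN0 : N ≠ ⊥)
    (hNt : N ≠ ⊤) : ∃ T : nestAlg 𝒩, T ≠ 0 ∧ T * T = 0 := by
  obtain ⟨x, hx, hx0⟩ := Submodule.exists_mem_ne_zero_of_ne_bot hN0
  obtain ⟨z, hz⟩ : ∃ z, z ∉ N := by
    by_contra! h1
    exact hNt (Submodule.eq_top_iff'.2 h1)
  obtain ⟨f, hf, hfz⟩ := exists_annihilator (h𝒩.isClosed N hN) hz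
  refine ⟨⟨f.smulRight x, h𝒩.smulRight_mem hN hf hx⟩, fun h => hx0 ?_,
    subalgebra_ext fun v => by simp [hf x hx]⟩
  have := congrArg (fun T : nestAlg 𝒩 => (T : X →L[ℂ] X) z) h
  simpa [hfz] using this

theorem IsNest.scalarOfLieScalar (h𝒩 : IsNest 𝒩) {N : Submodule ℂ X} (hN : N ∈ 𝒩) (hN0 : N ≠ ⊥)
    (hNt : N ≠ ⊤) : ScalarOfLieScalar (nestAlg 𝒩) := by
  obtain ⟨T, hT, hTT⟩ := h𝒩.exists_sq_zero hN hN0 hNt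
  obtain ⟨x, hx, hx0⟩ := Submodule.exists_mem_ne_zero_of_ne_bot hN0
  refine scalarOfLieScalar_of_dense hT hTT hx0 ?_
  rcases dense_or_exists 𝒩 with hd | ⟨f, hf, hfu⟩
  · refine (Submodule.dense_iff_topologicalClosure_eq_top.2 hd).mono fun y hy => ?_
    obtain ⟨M, hM, hMt, hNM, hyM⟩ := h𝒩.exists_ge hN hNt hy
    obtain ⟨z, hz⟩ : ∃ z, z ∉ M := by
      by_contra! h1
      exact hMt (Submodule.eq_top_iff'.2 h1)
    obtain ⟨f, hf, hfz⟩ := exists_annihilator (h𝒩.isClosed M hM) hz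
    exact ⟨f, by rintro rfl; simp at hfz, h𝒩.smulRight_mem hM hf hyM,
      h𝒩.smulRight_mem hM hf (hNM hx)⟩
  · exact dense_univ.mono fun y _ => ⟨f, hf, hfu y, hfu x⟩

theorem IsNest.isDerivationModCentroid (h𝒩 : IsNest 𝒩) {N : Submodule ℂ X} (hN : N ∈ 𝒩)
    (hN0 : N ≠ ⊥) (hNt : N ≠ ⊤) {n : ℕ} (hn : 2 ≤ n) {L : nestAlg 𝒩 →ₗ[ℂ] (X →L[ℂ] X)}
    (hL : IsLieDerivation n L) : IsDerivationModCentroid L := by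
  rcases dense_or_exists 𝒩 with hd | ⟨f, hf, hfu⟩
  · exact isDerivationModCentroid_of_properSpan_dense h𝒩 hd hN hN0 hNt
      (hL.respectsCommutatorRelations (h𝒩.scalarOfLieScalar hN hN0 hNt) hn)
  · obtain ⟨e, he⟩ := exists_eq_one_of_ne_zero hf
    exact hL.isDerivationModCentroid_of_rankOne hfu he hn

end Main

end NestLie

theorem theorem3p1 {X : Type*} [NormedAddCommGroup X] [NormedSpace ℂ X] [CompleteSpace X]
    (𝒩 : Set (Submodule ℂ X)) (h𝒩 : NestLie.IsNest 𝒩) (hnontriv : 𝒩 ≠ {⊥, ⊤})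
    (n : ℕ) (hn : 2 ≤ n) (L : NestLie.nestAlg 𝒩 →ₗ[ℂ] (X →L[ℂ] X)) :
    (NestLie.IsLieDerivation n L ↔
      ∃ D H : NestLie.nestAlg 𝒩 →ₗ[ℂ] (X →L[ℂ] X), NestLie.IsStandardForm n L D H) ∧
    (Continuous L →
      ∀ D H : NestLie.nestAlg 𝒩 →ₗ[ℂ] (X →L[ℂ] X), NestLie.IsStandardForm n L D H →
        Continuous D ∧ Continuous H) := by
  obtain ⟨N, hN, hN0, hNt⟩ := h𝒩.exists_nontrivial hnontriv
  obtain ⟨T, hT, hTT⟩ := h𝒩.exists_sq_zero hN hN0 hNt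
  have hns : ∃ a : NestLie.nestAlg 𝒩, ∀ s : ℂ, (a : X →L[ℂ] X) ≠ s • (1 : X →L[ℂ] X) := by
    refine ⟨T, fun s hs => hT ?_⟩
    have h1 : T = s • (1 : NestLie.nestAlg 𝒩) := Subtype.ext hs
    have h2 : s • T = 0 := by rw [← hTT]; nth_rw 2 [h1]; simp
    rcases smul_eq_zero.1 h2 with h | h
    · rw [h1, h, zero_smul]
    · exact h
  refine ⟨⟨fun hL => ?_, fun ⟨D, H, h⟩ => h.isLieDerivation hn⟩, fun hL D H h =>
    h.continuous (NestLie.isClosed_nestAlg h𝒩) hns hL⟩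
  exact (h𝒩.isDerivationModCentroid hN hN0 hNt hn hL).exists_isStandardForm
    (h𝒩.scalarOfLieScalar hN hN0 hNt) hns hn hL
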